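/- **Setting.** Let $m\ge 1$, let $R:\mathbb R^n\to\mathbb R\cup\{+\infty\}$ be proper, convex and lower semicontinuous, let $f_1,\dots,f_m:\mathbb R^n\to\mathbb R$ be continuously differentiable with $L_i$-Lipschitz gradients, put $L=\max_i L_i$, and assume that $F=\frac1m\sum_{i=1}^m f_i$ is convex. Let $\Phi=R+F$ and assume $\operatorname{Argmin}\Phi\neq\emptyset$. For $\gamma>0$ let $\operatorname{prox}_{\gamma R}(z)$ be the minimiser of $\gamma R(x)+\frac12\|x-z\|^2$ over $x\in\mathbb R^n$. A function $g$ is called $\alpha$-strongly convex ($\alpha>0$) if $g-\frac\alpha2\|\cdot\|^2$ is convex. Let $P\ge1$, $\gamma>0$ and $\tilde x_0\in\mathbb R^n$. Prox-SVRG with constant step-size $\gamma$ and Option I computes, for $\ell=0,1,2,\dots$: $x_{\ell,0}=\tilde x_\ell$; for $p=1,\dots,P$, an index $i_{\ell,p}$ is sampled uniformly from $\{1,\dots,m\}$, independently of all other samples, and $$x_{\ell,p}=\operatorname{prox}_{\gamma R}\bigl(x_{\ell,p-1}-\gamma v_{\ell,p}\bigr),\qquad v_{\ell,p}=\nabla f_{i_{\ell,p}}(x_{\ell,p-1})-\nabla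 f_{i_{\ell,p}}(\tilde x_\ell)+\tfrac1m\sum_{i=1}^m\nabla f_i(\tilde x_\ell);$$ finally $\tilde x_{\ell+1}=x_{\ell,P}$. Write $x_k=x_{\ell,p}$ for $k=\ell P+p$; let $\varepsilon_k=v_{\ell,p+1}-\nabla F(x_k)$ for $k=\ell P+p$, $0\le p<P$, be the gradient error of the step from $x_k$ to $x_{k+1}$; and let $\bar x_k=\frac1k\sum_{j=1}^k x_j$. **Theorem.** (i) Suppose $4L\gamma(P+2)\le1$ (i.e. $\gamma\le\frac1{4L(P+2)}$ if $L>0$). Then there is a random variable $X$ such that, almost surely, $X\in\operatorname{Argmin}\Phi$, $x_k\to X$ and $\varepsilon_k\to0$. Moreover, for every $x^\star\in\operatorname{Argmin}\Phi$ and every $k=\ell P$ with $\ell\ge1$, $$\mathbb E[\Phi(\bar x_k)-\Phi(x^\star)]\le\frac{1}{2\gamma\,(1-4L\gamma(P+1))\,k}\Bigl(\|\tilde x_0-x^\star\|^2+8L\gamma^2(P+1)\bigl(\Phi(\tilde x_0)-\Phi(x^\star)\bigr)\Bigr),$$ and, if in addition $8L\gamma^2(P+1)\le 2\gamma-\gamma^2$,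 also $$\mathbb E[\Phi(\bar x_k)-\Phi(x^\star)]\le\frac{1}{k\gamma^2}\Bigl(\|\tilde x_0-x^\star\|^2+(2\gamma-\gamma^2)\bigl(\Phi(\tilde x_0)-\Phi(x^\star)\bigr)\Bigr).$$ (ii) Suppose that $R$ and $F$ are $\alpha_R$- and $\alpha_F$-strongly convex, with $\alpha_R,\alpha_F>0$, and that $4L\gamma(P+1)<1$. Then $\rho=\max\bigl\{\frac{1-\gamma\alpha_F}{1+\gamma\alpha_R},\,4L\gamma(P+1)\bigr\}<1$, and for $x^\star\in\operatorname{Argmin}\Phi$ and every $\ell\in\mathbb N$, $$\mathbb E\|\tilde x_\ell-x^\star\|^2\le\rho^\ell\Bigl(\|\tilde x_0-x^\star\|^2+\tfrac{2\gamma}{1+\gamma\alpha_R}\bigl(\Phi(\tilde x_0)-\Phi(x^\star)\bigr)\Bigr).$$ (The right-hand sides are read in $[0,+\infty]$, since $\Phi(\tilde x_0)=+\infty$ is allowed, with the convention $0\cdot\infty=0$.) -/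

import Mathlib

open MeasureTheory ProbabilityTheory Filter Topology
open scoped NNReal ENNReal

namespace ProxSVRG

/-- Euclidean space `ℝⁿ`. -/
abbrev Vec (n : ℕ) : Type := EuclideanSpace ℝ (Fin n)

/-- An extended-real-valued function is convex if its epigraph is convex. -/
def ConvexFun {n : ℕ} (g : Vec n → EReal) : Prop :=
  Convex ℝ {p : Vec n × ℝ | g p.1 ≤ (p.2 : EReal)}

/-- `g` is `α`-strongly convex if `g - (α / 2) ‖·‖²` is convex. -/
def StronglyConvexFun {n : ℕ} (α : ℝ) (g : Vec n → EReal) : Prop :=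
  ConvexFun fun x => g x - ((α / 2 * ‖x‖ ^ 2 : ℝ) : EReal)

/-- A function with values in `ℝ ∪ {+∞}` that is not identically `+∞`. -/
def Proper {n : ℕ} (g : Vec n → EReal) : Prop :=
  (∀ x, g x ≠ ⊥) ∧ ∃ x, g x ≠ ⊤

/-- The finite average `F = (1/m) ∑ᵢ fᵢ`. -/
noncomputable def avg {n m : ℕ} (f : Fin m → Vec n → ℝ) (x : Vec n) : ℝ :=
  (1 / (m : ℝ)) * ∑ i, f i x

/-- The objective `Φ = R + F`. -/
noncomputable def objective {n m : ℕ} (R : Vec n → EReal) (f : Fin m → Vec n → ℝ)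
    (x : Vec n) : EReal :=
  R x + (avg f x : EReal)

/-- The set of global minimisers. -/
def Argmin {n : ℕ} (g : Vec n → EReal) : Set (Vec n) :=
  {x | ∀ y, g x ≤ g y}

/-- The gap `g x - g xs`; it is used for `xs` a minimiser of a proper `g`, so that it is a
well-defined element of `[0, +∞]`. -/
noncomputable def gap {n : ℕ} (g : Vec n → EReal) (xs x : Vec n) : ℝ≥0∞ :=
  (g x - g xs).toENNReal

/-- The proximity operator `prox_{γ R} z`, that is a minimiser of `γ R + ½ ‖· - z‖²`
(for `γ > 0` and `R` proper, convex, lower semicontinuous it exists and is unique). -/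
noncomputable def prox {n : ℕ} (γ : ℝ) (R : Vec n → EReal) (z : Vec n) : Vec n :=
  Classical.epsilon fun y =>
    y ∈ Argmin fun x => (γ : EReal) * R x + ((1 / 2 * ‖x - z‖ ^ 2 : ℝ) : EReal)

/-- The variance-reduced gradient estimate at `x` with reference point `xt` and sampled index `j`:
`∇f_j(x) - ∇f_j(xt) + (1/m) ∑ᵢ ∇fᵢ(xt)`. -/
noncomputable def vrGrad {n m : ℕ} (f : Fin m → Vec n → ℝ) (xt : Vec n) (j : Fin m)
    (x : Vec n) : Vec n :=
  gradient (f j) x - gradient (f j) xt + (1 / (m : ℝ)) • ∑ i, gradient (f i) xt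

/-- The inner loop started at the reference point `xt`: after `p` steps with sampled indices
`s 0, …, s (p - 1)`. -/
noncomputable def inner {n m : ℕ} (γ : ℝ) (R : Vec n → EReal) (f : Fin m → Vec n → ℝ)
    (xt : Vec n) (s : ℕ → Fin m) : ℕ → Vec n
  | 0 => xt
  | p + 1 =>
      prox γ R (inner γ R f xt s p - γ • vrGrad f xt (s p) (inner γ R f xt s p))

/-- The outer sequence `x̃_ℓ` with "Option I" (`x̃_{ℓ+1} = x_{ℓ,P}`) and inner loops of length `P`.
The sampled indices are listed consecutively: `s (ℓ P + p - 1)` is the index drawn to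
compute `x_{ℓ,p}`, `1 ≤ p ≤ P`. -/
noncomputable def outer {n m : ℕ} (γ : ℝ) (P : ℕ) (R : Vec n → EReal) (f : Fin m → Vec n → ℝ)
    (x0 : Vec n) (s : ℕ → Fin m) : ℕ → Vec n
  | 0 => x0
  | l + 1 => inner γ R f (outer γ P R f x0 s l) (fun p => s (l * P + p)) P

/-- The flattened sequence `x_k = x_{ℓ,p}`, `k = ℓ P + p` with `0 ≤ p < P` (note that
`x_{ℓ,P} = x_{ℓ+1,0}`). -/
noncomputable def iter {n m : ℕ} (γ : ℝ) (P : ℕ) (R : Vec n → EReal) (f : Fin m → Vec n → ℝ)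
    (x0 : Vec n) (s : ℕ → Fin m) (k : ℕ) : Vec n :=
  inner γ R f (outer γ P R f x0 s (k / P)) (fun p => s (k / P * P + p)) (k % P)

/-- The stochastic error `ε_k` of the step from `x_k` to
`x_{k+1} = prox_{γ R} (x_k - γ (∇F(x_k) + ε_k))`. -/
noncomputable def err {n m : ℕ} (γ : ℝ) (P : ℕ) (R : Vec n → EReal) (f : Fin m → Vec n → ℝ)
    (x0 : Vec n) (s : ℕ → Fin m) (k : ℕ) : Vec n :=
  vrGrad f (outer γ P R f x0 s (k / P)) (s k) (iter γ P R f x0 s k)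
    - gradient (avg f) (iter γ P R f x0 s k)

/-- The ergodic average `x̄_k = (1/k) ∑_{j=1}^k x_j`. -/
noncomputable def ergodic {n m : ℕ} (γ : ℝ) (P : ℕ) (R : Vec n → EReal)
    (f : Fin m → Vec n → ℝ) (x0 : Vec n) (s : ℕ → Fin m) (k : ℕ) : Vec n :=
  (1 / (k : ℝ)) • ∑ j ∈ Finset.Icc 1 k, iter γ P R f x0 s j

end ProxSVRG

/-! The squared lengths of the steps pay for the variance of the gradient estimate. For a minimiser
`xs`, the variational inequality of the prox, the descent lemma and convexity of F give, after
averaging over the sampled index (`mean_step_inequality`), (1+γα_R) E‖x_{k+1}-xs‖² + 2γ E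
gap(x_{k+1}) + (1/2-γL) E‖x_{k+1}-x_k‖² ≤ (1-γα_F) ‖x_k-xs‖² + 2γ²L² ‖x_k-x̃‖², with x̃ the current
reference point. The last term bounds the variance; the part linear in the error averages to zero.

Cauchy–Schwarz bounds ‖x_k-x̃‖² by P times S_k, the sum of the squared steps since x̃ (`stepSum`).
In `energy`, S_k has weight 2γ²L²P times the number of steps left in the epoch. The drop of this
weight by one at each step pays for the variance, and the new step costs at most 2γ²L²P² times its
square, which the step-size condition keeps below 1/2-γL with 1/4 to spare (`step_size_bounds`).

In the convex case the energy is therefore a nonnegative supermartingale: almost surely the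
distances to a minimiser converge, the squared steps are summable and the gaps vanish, so an Opial
argument yields the limit. Summing the decrease bounds the mean gap of the averages by
‖x̃_0-xs‖²/(2γk), which is below both stated right-hand sides. In the strongly convex case S_k
vanishes at the ends of the epochs, and each epoch contracts by (1-γα_F)/(1+γα_R). -/

namespace ProxSVRG

/-! ### First-order inequalities -/

section Smooth

variable {E : Type*} [NormedAddCommGroup E] [InnerProductSpace ℝ E] [CompleteSpace E]

lemma hasDerivAt_comp_line {F : E → ℝ} {x d : E} {t : ℝ} {g : E}
    (h : HasGradientAt F g (x + t • d)) :
    HasDerivAt (fun t : ℝ => F (x + t • d)) (Inner.inner ℝ g d) t := by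
  have h1 : HasDerivAt (fun t : ℝ => x + t • d) d t := by
    simpa using ((hasDerivAt_id t).smul_const d).const_add x
  have h2 := h.hasFDerivAt.comp_hasDerivAt t h1
  exact h2.congr_deriv (by simp)

/-- The descent lemma. -/
lemma descent_lemma {F : E → ℝ} {L : ℝ} (hF : Differentiable ℝ F)
    (hL : ∀ x y, ‖gradient F x - gradient F y‖ ≤ L * ‖x - y‖) (x y : E) :
    F y ≤ F x + Inner.inner ℝ (gradient F x) (y - x) + L / 2 * ‖y - x‖ ^ 2 := by
  set d := y - x with hd
  -- The difference between F on the segment and its quadratic upper model, up to a constant; the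
  -- Lipschitz bound makes its derivative nonpositive for `t ≥ 0`.
  let g : ℝ → ℝ := fun t => F (x + t • d) - t * Inner.inner ℝ (gradient F x) d
    - L / 2 * ‖d‖ ^ 2 * t ^ 2
  have hg : ∀ t, HasDerivAt g (Inner.inner ℝ (gradient F (x + t • d)) d
      - Inner.inner ℝ (gradient F x) d - L * ‖d‖ ^ 2 * t) t := by
    intro t
    have h1 := hasDerivAt_comp_line (d := d) (hF (x + t • d)).hasGradientAt
    have h2 := (h1.sub ((hasDerivAt_id t).mul_const (Inner.inner ℝ (gradient F x) d))).sub
      ((hasDerivAt_pow 2 t).const_mul (L / 2 * ‖d‖ ^ 2))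
    refine h2.congr_deriv ?_
    simp
    ring
  have hanti : AntitoneOn g (Set.Icc 0 1) := by
    refine antitoneOn_of_deriv_nonpos (convex_Icc 0 1)
      (fun t _ => (hg t).continuousAt.continuousWithinAt)
      (fun t _ => (hg t).differentiableAt.differentiableWithinAt) ?_
    intro t ht
    rw [interior_Icc] at ht
    rw [(hg t).deriv, ← inner_sub_left]
    have h1 := real_inner_le_norm (gradient F (x + t • d) - gradient F x) d
    have h2 := hL (x + t • d) x
    rw [add_sub_cancel_left, norm_smul, Real.norm_of_nonneg ht.1.le] at h2
    have h3 := mul_le_mul_of_nonneg_right h2 (norm_nonneg d)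
    nlinarith
  have := hanti (Set.left_mem_Icc.2 zero_le_one) (Set.right_mem_Icc.2 zero_le_one) zero_le_one
  simp only [g, zero_smul, one_smul, add_zero] at this
  have hxy : x + d = y := by simp [hd]
  rw [hxy] at this
  linarith

/-- The quadratic lower bound of a differentiable strongly convex function. -/
lemma strongConvexOn_lower_bound {F : E → ℝ} {α : ℝ} (hF : Differentiable ℝ F)
    (hα : StrongConvexOn Set.univ α F) (x y : E) :
    F x + Inner.inner ℝ (gradient F x) (y - x) + α / 2 * ‖y - x‖ ^ 2 ≤ F y := by
  set d := y - x with hd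
  have h1 : HasDerivAt (fun t : ℝ => F (x + t • d)) (Inner.inner ℝ (gradient F x) d) 0 :=
    hasDerivAt_comp_line (by simpa using (hF x).hasGradientAt)
  have h2 := h1.tendsto_slope_zero_right
  have h3 : Tendsto (fun t : ℝ => F y - F x - α / 2 * (1 - t) * ‖d‖ ^ 2) (𝓝[>] 0)
      (𝓝 (F y - F x - α / 2 * (1 - 0) * ‖d‖ ^ 2)) := by
    refine Tendsto.mono_left (Continuous.tendsto ?_ _) nhdsWithin_le_nhds
    fun_prop
  -- Strong convexity between `x` and `y` bounds the difference quotient at each `t` in (0, 1]; the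
  -- limit `t → 0` turns it into the directional derivative.
  have h4 := le_of_tendsto_of_tendsto h2 h3 ?_
  · linarith
  have hmem : Set.Ioc (0 : ℝ) 1 ∈ 𝓝[>] (0 : ℝ) := Ioc_mem_nhdsGT one_pos
  filter_upwards [hmem] with t ht
  have h5 := hα.2 (Set.mem_univ x) (Set.mem_univ y) (sub_nonneg.2 ht.2) ht.1.le
    (sub_add_cancel 1 t)
  have h6 : (1 - t) • x + t • y = x + t • d := by rw [hd]; module
  rw [h6, norm_sub_rev] at h5
  simp only [smul_eq_mul, zero_add, zero_smul, add_zero] at h5 ⊢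
  rw [inv_mul_le_iff₀ ht.1]
  rw [← hd] at h5
  linarith

end Smooth

/-! ### Extended-real-valued convex functions -/

section Extended

variable {n m : ℕ} {R : Vec n → EReal}

lemma StronglyConvexFun.strongConvexOn {α : ℝ} (hR : ∀ x, R x ≠ ⊥)
    (h : StronglyConvexFun α R) :
    StrongConvexOn {x | R x ≠ ⊤} α (fun x => (R x).toReal) := by
  have key : ∀ x, R x ≠ ⊤ → ∀ u, R u ≠ ⊤ → ∀ a b : ℝ, 0 ≤ a → 0 ≤ b → a + b = 1 →
      R (a • x + b • u) ≤ ((a * ((R x).toReal - α / 2 * ‖x‖ ^ 2)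
        + b * ((R u).toReal - α / 2 * ‖u‖ ^ 2) + α / 2 * ‖a • x + b • u‖ ^ 2 : ℝ) : EReal) := by
    intro x hx u hu a b ha hb hab
    have hmem : ∀ y, R y ≠ ⊤ → (y, (R y).toReal - α / 2 * ‖y‖ ^ 2) ∈
        {p : Vec n × ℝ | R p.1 - ((α / 2 * ‖p.1‖ ^ 2 : ℝ) : EReal) ≤ (p.2 : EReal)} := by
      intro y hy
      have : R y = ((R y).toReal : EReal) := (EReal.coe_toReal hy (hR y)).symm
      simp only [Set.mem_ofPred_eq]
      rw [this, ← EReal.coe_sub, EReal.toReal_coe]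
    have := h (hmem x hx) (hmem u hu) ha hb hab
    simp only [Set.mem_ofPred_eq, Prod.smul_mk, Prod.mk_add_mk, smul_eq_mul] at this
    rw [EReal.sub_le_iff_le_add (Or.inl (EReal.coe_ne_bot _)) (Or.inl (EReal.coe_ne_top _)),
      ← EReal.coe_add] at this
    exact this
  have hconv : Convex ℝ {x | R x ≠ ⊤} := fun x hx u hu a b ha hb hab =>
    ne_top_of_le_ne_top (EReal.coe_ne_top _) (key x hx u hu a b ha hb hab)
  rw [strongConvexOn_iff_convex]
  refine ⟨hconv, fun x hx u hu a b ha hb hab => ?_⟩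
  have h1 := key x hx u hu a b ha hb hab
  rw [← EReal.coe_toReal (hconv hx hu ha hb hab) (hR _), EReal.coe_le_coe_iff] at h1
  simp only [smul_eq_mul]
  linarith

lemma ConvexFun.convexOn_toReal (hR : ∀ x, R x ≠ ⊥) (h : ConvexFun R) :
    ConvexOn ℝ {x | R x ≠ ⊤} (fun x => (R x).toReal) := by
  rw [← strongConvexOn_zero]
  refine StronglyConvexFun.strongConvexOn hR ?_
  simpa [StronglyConvexFun] using h

lemma lowerSemicontinuous_add_coe {g : Vec n → EReal} (hg : LowerSemicontinuous g)
    {q : Vec n → ℝ} (hq : Continuous q) :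
    LowerSemicontinuous (fun x => g x + (q x : EReal)) := by
  refine hg.add' (continuous_coe_real_ereal.comp hq).lowerSemicontinuous fun x => ?_
  exact EReal.continuousAt_add (Or.inr (EReal.coe_ne_bot _)) (Or.inr (EReal.coe_ne_top _))

lemma lowerSemicontinuous_coe_mul (hR : LowerSemicontinuous R) {γ : ℝ} (hγ : 0 < γ) :
    LowerSemicontinuous (fun x => (γ : EReal) * R x) := by
  have hγ0 : (γ : EReal) ≠ 0 := by exact_mod_cast hγ.ne'
  have hcont : Continuous (fun y : EReal => (γ : EReal) * y) := by
    rw [continuous_iff_continuousAt]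
    intro y
    exact ContinuousAt.comp (f := fun y : EReal => ((γ : EReal), y))
      (EReal.continuousAt_mul (Or.inl hγ0) (Or.inl hγ0) (Or.inl (EReal.coe_ne_bot _))
        (Or.inl (EReal.coe_ne_top _))) (by fun_prop)
  exact hcont.comp_lowerSemicontinuous hR
    (fun a b hab => mul_le_mul_of_nonneg_left hab (by exact_mod_cast hγ.le))

end Extended

/-! ### The proximity operator -/

section Prox

variable {n : ℕ} {R : Vec n → EReal}

lemma coe_mul_add_eq {γ : ℝ} (hR : ∀ x, R x ≠ ⊥) {x : Vec n} (hx : R x ≠ ⊤) (c : ℝ) :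
    (γ : EReal) * R x + (c : EReal) = ((γ * (R x).toReal + c : ℝ) : EReal) := by
  rw [EReal.coe_add, EReal.coe_mul, EReal.coe_toReal hx (hR x)]

lemma coe_mul_add_ne_top_iff {γ : ℝ} (hγ : 0 < γ) {x : Vec n} (hR : ∀ x, R x ≠ ⊥) (c : ℝ) :
    (γ : EReal) * R x + (c : EReal) ≠ ⊤ ↔ R x ≠ ⊤ := by
  refine ⟨fun h hx => h ?_, fun h => ?_⟩
  · rw [hx, EReal.coe_mul_top_of_pos hγ, EReal.top_add_coe]
  · rw [coe_mul_add_eq hR h]; exact EReal.coe_ne_top _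

/-- The proximal objective attains its minimum if `R` is bounded below by a quadratic function of
small curvature. -/
lemma exists_mem_argmin_prox {γ : ℝ} (hγ : 0 < γ) (hR : ∀ x, R x ≠ ⊥) (hlsc : LowerSemicontinuous R)
    {x₀ : Vec n} (hx₀ : R x₀ ≠ ⊤) {L : ℝ} (hL : γ * L < 1) {g : Vec n}
    (hlow : ∀ u, R u ≠ ⊤ →
      (R x₀).toReal - Inner.inner ℝ g (u - x₀) - L / 2 * ‖u - x₀‖ ^ 2 ≤ (R u).toReal) (z : Vec n) :
    ∃ y, y ∈ Argmin fun x => (γ : EReal) * R x + ((1 / 2 * ‖x - z‖ ^ 2 : ℝ) : EReal) := by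
  set ψ : Vec n → EReal := fun x => (γ : EReal) * R x + ((1 / 2 * ‖x - z‖ ^ 2 : ℝ) : EReal) with hψ
  have hψlsc : LowerSemicontinuous ψ :=
    lowerSemicontinuous_add_coe (lowerSemicontinuous_coe_mul hlsc hγ) (by fun_prop)
  set b := γ * ‖g‖ + ‖x₀ - z‖ with hb
  have hb0 : 0 ≤ b := by positivity
  -- At distance d from `x₀` the objective exceeds its value at `x₀` by at least (1-γL)d²/2 - bd,
  -- which is nonnegative once d ≥ r. So minimising over the compact ball suffices.
  set r := 2 * b / (1 - γ * L) with hr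
  have hr0 : 0 ≤ r := div_nonneg (by positivity) (by linarith)
  obtain ⟨y, hy, hmin⟩ := LowerSemicontinuousOn.exists_isMinOn (s := Metric.closedBall x₀ r)
    ⟨x₀, Metric.mem_closedBall_self hr0⟩ (isCompact_closedBall _ _) (hψlsc.lowerSemicontinuousOn _)
  refine ⟨y, fun u => ?_⟩
  by_cases hu : u ∈ Metric.closedBall x₀ r
  · exact hmin hu
  refine (hmin (Metric.mem_closedBall_self hr0)).trans ?_
  by_cases htop : R u = ⊤
  · simp only [hψ, htop, EReal.coe_mul_top_of_pos hγ, EReal.top_add_coe, le_top]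
  simp only [hψ]
  rw [coe_mul_add_eq hR htop, coe_mul_add_eq hR hx₀, EReal.coe_le_coe_iff]
  rw [Metric.mem_closedBall, dist_eq_norm, not_le, hr, div_lt_iff₀ (by linarith)] at hu
  have h1 := mul_le_mul_of_nonneg_left (hlow u htop) hγ.le
  have h2 := mul_le_mul_of_nonneg_left (real_inner_le_norm g (u - x₀)) hγ.le
  have h3 : ‖u - z‖ ^ 2 = ‖u - x₀‖ ^ 2 + 2 * Inner.inner ℝ (u - x₀) (x₀ - z) + ‖x₀ - z‖ ^ 2 := by
    rw [← norm_add_sq_real, sub_add_sub_cancel]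
  have h4 := neg_le_of_abs_le (abs_real_inner_le_norm (u - x₀) (x₀ - z))
  have h5 := mul_le_mul_of_nonneg_left hu.le (norm_nonneg (u - x₀))
  rw [h3]
  nlinarith

/-- The variational inequality satisfied by a proximal point of a (strongly) convex function. -/
lemma prox_inequality {γ α : ℝ} (hγ : 0 < γ) (hR : ∀ x, R x ≠ ⊥)
    (hconv : StrongConvexOn {x | R x ≠ ⊤} α (fun x => (R x).toReal)) {z y u : Vec n}
    (hu : R u ≠ ⊤)
    (hy : y ∈ Argmin fun x => (γ : EReal) * R x + ((1 / 2 * ‖x - z‖ ^ 2 : ℝ) : EReal)) :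
    R y ≠ ⊤ ∧ γ * (R y).toReal + 1 / 2 * ‖y - z‖ ^ 2 + (1 + γ * α) / 2 * ‖u - y‖ ^ 2
      ≤ γ * (R u).toReal + 1 / 2 * ‖u - z‖ ^ 2 := by
  have hyt : R y ≠ ⊤ := (coe_mul_add_ne_top_iff hγ hR _).1
    (ne_top_of_le_ne_top ((coe_mul_add_ne_top_iff hγ hR _).2 hu) (hy u))
  refine ⟨hyt, ?_⟩
  -- Minimality of `y` is tested at (1-t)y + tu; dividing by t and letting t → 0 recovers the full
  -- modulus 1+γα.
  have key : ∀ t ∈ Set.Ioo (0 : ℝ) 1,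
      γ * (R y).toReal + 1 / 2 * ‖y - z‖ ^ 2 + (1 + γ * α) / 2 * (1 - t) * ‖u - y‖ ^ 2
      ≤ γ * (R u).toReal + 1 / 2 * ‖u - z‖ ^ 2 := by
    intro t ht
    have hdom := hconv.1 hyt hu (by linarith [ht.2] : 0 ≤ 1 - t) ht.1.le (by ring)
    have h1 := hconv.2 hyt hu (by linarith [ht.2] : 0 ≤ 1 - t) ht.1.le (by ring)
    have h2 := hy ((1 - t) • y + t • u)
    simp only at h2
    rw [coe_mul_add_eq hR hyt, coe_mul_add_eq hR hdom, EReal.coe_le_coe_iff] at h2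
    have h3 : (1 - t) • y + t • u - z = (1 - t) • (y - z) + t • (u - z) := by module
    have h4 : u - y = (u - z) - (y - z) := by abel
    have h5 := mul_le_mul_of_nonneg_left h1 hγ.le
    simp only [smul_eq_mul] at h5
    rw [norm_sub_rev y u] at h5
    have h6 : ‖(1 - t) • (y - z) + t • (u - z)‖ ^ 2
        = (1 - t) * ‖y - z‖ ^ 2 + t * ‖u - z‖ ^ 2 - t * (1 - t) * ‖u - y‖ ^ 2 := by
      rw [h4, norm_add_sq_real, norm_sub_sq_real (u - z) (y - z), norm_smul, norm_smul,
        real_inner_smul_left, inner_smul_right, mul_pow, mul_pow, Real.norm_eq_abs,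
        Real.norm_eq_abs, sq_abs, sq_abs, real_inner_comm (u - z)]
      ring
    rw [h3, h6] at h2
    refine le_of_mul_le_mul_left ?_ ht.1
    linarith
  have hlim : Tendsto (fun t : ℝ => γ * (R y).toReal + 1 / 2 * ‖y - z‖ ^ 2
      + (1 + γ * α) / 2 * (1 - t) * ‖u - y‖ ^ 2) (𝓝[>] 0) (𝓝 (γ * (R y).toReal
      + 1 / 2 * ‖y - z‖ ^ 2 + (1 + γ * α) / 2 * (1 - 0) * ‖u - y‖ ^ 2)) := by
    refine Tendsto.mono_left (Continuous.tendsto ?_ _) nhdsWithin_le_nhds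
    fun_prop
  have := le_of_tendsto hlim (Filter.mem_of_superset (Ioo_mem_nhdsGT one_pos) key)
  linarith

end Prox

/-! ### The variance-reduced gradient -/

section VrGrad

variable {n m : ℕ} {f : Fin m → Vec n → ℝ}

lemma hasGradientAt_avg (hf : ∀ i, Differentiable ℝ (f i)) (x : Vec n) :
    HasGradientAt (avg f) ((1 / (m : ℝ)) • ∑ i, gradient (f i) x) x := by
  rw [hasGradientAt_iff_hasFDerivAt, map_smul, map_sum]
  have h : HasFDerivAt (fun y => ∑ i, f i y)
      (∑ i, InnerProductSpace.toDual ℝ (Vec n) (gradient (f i) x)) x :=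
    HasFDerivAt.fun_sum fun i _ => (hf i x).hasGradientAt.hasFDerivAt
  exact h.const_mul (1 / (m : ℝ))

lemma gradient_avg (hf : ∀ i, Differentiable ℝ (f i)) (x : Vec n) :
    gradient (avg f) x = (1 / (m : ℝ)) • ∑ i, gradient (f i) x :=
  (hasGradientAt_avg hf x).gradient

lemma differentiable_avg (hf : ∀ i, Differentiable ℝ (f i)) : Differentiable ℝ (avg f) :=
  fun x => (hasGradientAt_avg hf x).differentiableAt

lemma norm_gradient_avg_sub_le (hm : 0 < m) (hf : ∀ i, Differentiable ℝ (f i)) {L : ℝ}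
    (hL : ∀ i x y, ‖gradient (f i) x - gradient (f i) y‖ ≤ L * ‖x - y‖) (x y : Vec n) :
    ‖gradient (avg f) x - gradient (avg f) y‖ ≤ L * ‖x - y‖ := by
  have hm' : (0 : ℝ) < m := by exact_mod_cast hm
  rw [gradient_avg hf, gradient_avg hf, ← smul_sub, ← Finset.sum_sub_distrib, norm_smul,
    Real.norm_of_nonneg (by positivity), one_div, inv_mul_le_iff₀ hm']
  refine (norm_sum_le _ _).trans ((Finset.sum_le_sum fun i _ => hL i x y).trans ?_)
  simp

/-- The error of the variance-reduced gradient at `x` with reference point `y`. -/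
noncomputable def vrErr (f : Fin m → Vec n → ℝ) (y : Vec n) (j : Fin m) (x : Vec n) : Vec n :=
  vrGrad f y j x - gradient (avg f) x

lemma vrErr_eq (hf : ∀ i, Differentiable ℝ (f i)) (x y : Vec n) (j : Fin m) :
    vrErr f y j x = (gradient (f j) x - gradient (f j) y)
      - (gradient (avg f) x - gradient (avg f) y) := by
  rw [vrErr, vrGrad, ← gradient_avg hf]
  abel

lemma sum_gradient_sub (hm : 0 < m) (hf : ∀ i, Differentiable ℝ (f i)) (x y : Vec n) :
    ∑ j, (gradient (f j) x - gradient (f j) y)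
      = (m : ℝ) • (gradient (avg f) x - gradient (avg f) y) := by
  have hm' : (m : ℝ) ≠ 0 := by exact_mod_cast hm.ne'
  rw [gradient_avg hf, gradient_avg hf, ← smul_sub, smul_smul, mul_one_div_cancel hm', one_smul,
    Finset.sum_sub_distrib]

lemma sum_vrErr (hm : 0 < m) (hf : ∀ i, Differentiable ℝ (f i)) (x y : Vec n) :
    ∑ j, vrErr f y j x = 0 := by
  simp_rw [vrErr_eq hf, Finset.sum_sub_distrib (f := fun j => gradient (f j) x - gradient (f j) y),
    sum_gradient_sub hm hf]
  rw [Finset.sum_const, Finset.card_univ, Fintype.card_fin, ← Nat.cast_smul_eq_nsmul ℝ, sub_self]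

/-- The error is the centred version of ∇f_j(x) - ∇f_j(y), so its variance is at most the second
moment. This saves the factor 4 that the pointwise bound `norm_vrErr_le` would cost. -/
lemma sum_norm_vrErr_sq_le (hm : 0 < m) (hf : ∀ i, Differentiable ℝ (f i)) {L : ℝ}
    (hL : ∀ i x y, ‖gradient (f i) x - gradient (f i) y‖ ≤ L * ‖x - y‖) (x y : Vec n) :
    ∑ j, ‖vrErr f y j x‖ ^ 2 ≤ m * (L ^ 2 * ‖x - y‖ ^ 2) := by
  set c := gradient (avg f) x - gradient (avg f) y with hc
  have h1 : ∀ j, ‖vrErr f y j x‖ ^ 2 = ‖gradient (f j) x - gradient (f j) y‖ ^ 2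
      - 2 * Inner.inner ℝ (gradient (f j) x - gradient (f j) y) c + ‖c‖ ^ 2 := by
    intro j
    rw [vrErr_eq hf, norm_sub_sq_real]
  have h2 : ∑ j, Inner.inner ℝ (gradient (f j) x - gradient (f j) y) c = m * ‖c‖ ^ 2 := by
    rw [← sum_inner, sum_gradient_sub hm hf, ← hc, real_inner_smul_left,
      real_inner_self_eq_norm_sq]
  have h3 : ∑ j, ‖gradient (f j) x - gradient (f j) y‖ ^ 2 ≤ m * (L ^ 2 * ‖x - y‖ ^ 2) := by
    calc ∑ j, ‖gradient (f j) x - gradient (f j) y‖ ^ 2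
        ≤ ∑ _j : Fin m, L ^ 2 * ‖x - y‖ ^ 2 := by
          refine Finset.sum_le_sum fun j _ => ?_
          rw [← mul_pow]
          exact pow_le_pow_left₀ (norm_nonneg _) (hL j x y) 2
      _ = m * (L ^ 2 * ‖x - y‖ ^ 2) := by simp
  have h4 : ∑ j, ‖vrErr f y j x‖ ^ 2
      = ∑ j, ‖gradient (f j) x - gradient (f j) y‖ ^ 2 - m * ‖c‖ ^ 2 := by
    simp_rw [h1, Finset.sum_add_distrib, Finset.sum_sub_distrib, ← Finset.mul_sum, h2]
    simp
    ring
  have : 0 ≤ (m : ℝ) * ‖c‖ ^ 2 := by positivity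
  linarith

lemma norm_vrErr_le (hm : 0 < m) (hf : ∀ i, Differentiable ℝ (f i)) {L : ℝ}
    (hL : ∀ i x y, ‖gradient (f i) x - gradient (f i) y‖ ≤ L * ‖x - y‖) (x y : Vec n) (j : Fin m) :
    ‖vrErr f y j x‖ ≤ 2 * L * ‖x - y‖ := by
  rw [vrErr_eq hf]
  refine (norm_sub_le _ _).trans ?_
  linarith [hL j x y, norm_gradient_avg_sub_le hm hf hL x y]

end VrGrad

/-! ### One step of the algorithm -/

section Step

variable {n m : ℕ} {R : Vec n → EReal} {f : Fin m → Vec n → ℝ}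

/-- One step from `x` with reference point `y` and sampled index `j`. -/
noncomputable def step (γ : ℝ) (R : Vec n → EReal) (f : Fin m → Vec n → ℝ)
    (y : Vec n) (j : Fin m) (x : Vec n) : Vec n :=
  prox γ R (x - γ • vrGrad f y j x)

/-- The real-valued gap of the objective, meaningful on the domain of `R`. -/
noncomputable def realGap (R : Vec n → EReal) (f : Fin m → Vec n → ℝ) (xs x : Vec n) : ℝ :=
  ((R x).toReal + avg f x) - ((R xs).toReal + avg f xs)

lemma objective_eq_coe (hR : ∀ x, R x ≠ ⊥) {x : Vec n} (hx : R x ≠ ⊤) :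
    objective R f x = (((R x).toReal + avg f x : ℝ) : EReal) := by
  rw [objective, EReal.coe_add, EReal.coe_toReal hx (hR x)]

lemma ne_top_of_mem_argmin (hR : Proper R) {xs : Vec n} (hxs : xs ∈ Argmin (objective R f)) :
    R xs ≠ ⊤ := by
  obtain ⟨x, hx⟩ := hR.2
  intro h
  have := hxs x
  rw [objective_eq_coe hR.1 hx, objective, h, EReal.top_add_coe, top_le_iff] at this
  exact EReal.coe_ne_top _ this

lemma realGap_nonneg (hR : Proper R) {xs : Vec n} (hxs : xs ∈ Argmin (objective R f))
    {x : Vec n} (hx : R x ≠ ⊤) : 0 ≤ realGap R f xs x := by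
  have := hxs x
  rw [objective_eq_coe hR.1 hx, objective_eq_coe hR.1 (ne_top_of_mem_argmin hR hxs),
    EReal.coe_le_coe_iff] at this
  exact sub_nonneg.2 this

lemma gap_eq_ofReal (hR : Proper R) {xs : Vec n} (hxs : xs ∈ Argmin (objective R f))
    {x : Vec n} (hx : R x ≠ ⊤) :
    gap (objective R f) xs x = ENNReal.ofReal (realGap R f xs x) := by
  rw [gap, objective_eq_coe hR.1 hx, objective_eq_coe hR.1 (ne_top_of_mem_argmin hR hxs),
    ← EReal.coe_sub, EReal.toENNReal_of_ne_top (EReal.coe_ne_top _), EReal.toReal_coe, realGap]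

/-- Existence of a minimiser of Φ replaces an affine minorant of `R`: from Φ ≥ Φ(xs), the bound R(u)
≥ R(xs) + F(xs) - F(u) holds, and the descent lemma bounds F(u) above by a quadratic of curvature L,
dominated by the prox term when γL < 1. -/
lemma argmin_prox_nonempty (hR : Proper R) (hlsc : LowerSemicontinuous R)
    (hF : Differentiable ℝ (avg f)) {L : ℝ}
    (hL : ∀ x y, ‖gradient (avg f) x - gradient (avg f) y‖ ≤ L * ‖x - y‖)
    {xs : Vec n} (hxs : xs ∈ Argmin (objective R f)) {γ : ℝ} (hγ : 0 < γ) (hγL : γ * L < 1)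
    (z : Vec n) :
    ∃ y, y ∈ Argmin fun x => (γ : EReal) * R x + ((1 / 2 * ‖x - z‖ ^ 2 : ℝ) : EReal) := by
  refine exists_mem_argmin_prox hγ hR.1 hlsc (ne_top_of_mem_argmin hR hxs) hγL
    (g := gradient (avg f) xs) (fun u hu => ?_) z
  have h1 := realGap_nonneg hR hxs hu
  have h2 := descent_lemma hF hL xs u
  rw [realGap] at h1
  linarith

/-- The energy inequality of one step, before averaging over the sampled index. -/
lemma step_inequality (hR : Proper R) (hlsc : LowerSemicontinuous R)
    (hF : Differentiable ℝ (avg f)) {L : ℝ}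
    (hL : ∀ x y, ‖gradient (avg f) x - gradient (avg f) y‖ ≤ L * ‖x - y‖)
    {xs : Vec n} (hxs : xs ∈ Argmin (objective R f)) {γ : ℝ} (hγ : 0 < γ) (hγL : γ * L < 1)
    {αR αF : ℝ}
    (hRconv : StrongConvexOn {x | R x ≠ ⊤} αR (fun x => (R x).toReal))
    (hFconv : StrongConvexOn Set.univ αF (avg f)) (y : Vec n) (j : Fin m) (x : Vec n) :
    R (step γ R f y j x) ≠ ⊤ ∧
    (1 + γ * αR) * ‖step γ R f y j x - xs‖ ^ 2 + 2 * γ * realGap R f xs (step γ R f y j x)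
      + (1 / 2 - γ * L) * ‖step γ R f y j x - x‖ ^ 2
      ≤ (1 - γ * αF) * ‖x - xs‖ ^ 2 + 2 * γ ^ 2 * ‖vrErr f y j x‖ ^ 2
        + 2 * γ * Inner.inner ℝ (vrErr f y j x) (xs - x) := by
  have hmem := Classical.epsilon_spec (argmin_prox_nonempty hR hlsc hF hL hxs hγ hγL
    (x - γ • vrGrad f y j x))
  change step γ R f y j x ∈ _ at hmem
  obtain ⟨h0, h1⟩ := prox_inequality hγ hR.1 hRconv (ne_top_of_mem_argmin hR hxs) hmem
  refine ⟨h0, ?_⟩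
  set w := step γ R f y j x
  set v := vrGrad f y j x with hv
  set g := gradient (avg f) x with hg
  set e := vrErr f y j x with he
  have hve : v = g + e := by rw [he, vrErr]; abel
  have h2 := descent_lemma hF hL x w
  have h3 := strongConvexOn_lower_bound hF hFconv x xs
  have e1 : ‖w - (x - γ • v)‖ ^ 2
      = ‖w - x‖ ^ 2 + 2 * (γ * Inner.inner ℝ v (w - x)) + γ ^ 2 * ‖v‖ ^ 2 := by
    rw [show w - (x - γ • v) = (w - x) + γ • v by abel, norm_add_sq_real, inner_smul_right,
      norm_smul, mul_pow, Real.norm_eq_abs, sq_abs, real_inner_comm]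
  have e2 : ‖xs - (x - γ • v)‖ ^ 2
      = ‖xs - x‖ ^ 2 + 2 * (γ * Inner.inner ℝ v (xs - x)) + γ ^ 2 * ‖v‖ ^ 2 := by
    rw [show xs - (x - γ • v) = (xs - x) + γ • v by abel, norm_add_sq_real, inner_smul_right,
      norm_smul, mul_pow, Real.norm_eq_abs, sq_abs, real_inner_comm]
  have e3 : Inner.inner ℝ v (w - x) = Inner.inner ℝ g (w - x) + Inner.inner ℝ e (w - x) := by
    rw [hve, inner_add_left]
  have e4 : Inner.inner ℝ v (xs - x) = Inner.inner ℝ g (xs - x) + Inner.inner ℝ e (xs - x) := by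
    rw [hve, inner_add_left]
  -- Young's inequality, as the square of 2γe + (w - x). After doubling the energy inequality, the
  -- prox supplies 1 as coefficient of ‖w-x‖²; this step takes 1/2 of it and the descent lemma γL,
  -- which leaves 1/2 - γL.
  have e5 : 0 ≤ 2 * γ ^ 2 * ‖e‖ ^ 2 + 1 / 2 * ‖w - x‖ ^ 2 + 2 * (γ * Inner.inner ℝ e (w - x)) := by
    have : ‖(2 * γ) • e + (w - x)‖ ^ 2
        = 4 * γ ^ 2 * ‖e‖ ^ 2 + 2 * (2 * γ * Inner.inner ℝ e (w - x)) + ‖w - x‖ ^ 2 := by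
      rw [norm_add_sq_real, real_inner_smul_left, norm_smul, mul_pow, Real.norm_eq_abs, sq_abs]
      ring
    have h := sq_nonneg ‖(2 * γ) • e + (w - x)‖
    rw [this] at h
    linarith
  rw [e1, e2, e3, e4, norm_sub_rev xs w, norm_sub_rev xs x] at h1
  rw [norm_sub_rev xs x] at h3
  rw [realGap]
  have h2' := mul_le_mul_of_nonneg_left h2 hγ.le
  have h3' := mul_le_mul_of_nonneg_left h3 hγ.le
  linarith

/-- The energy inequality of one step, averaged over the sampled index. -/
lemma mean_step_inequality (hm : 0 < m) (hR : Proper R) (hlsc : LowerSemicontinuous R)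
    (hf : ∀ i, Differentiable ℝ (f i)) {L : ℝ}
    (hL : ∀ i x y, ‖gradient (f i) x - gradient (f i) y‖ ≤ L * ‖x - y‖)
    {xs : Vec n} (hxs : xs ∈ Argmin (objective R f)) {γ : ℝ} (hγ : 0 < γ) (hγL : γ * L < 1)
    {αR αF : ℝ}
    (hRconv : StrongConvexOn {x | R x ≠ ⊤} αR (fun x => (R x).toReal))
    (hFconv : StrongConvexOn Set.univ αF (avg f)) (y x : Vec n) :
    1 / (m : ℝ) * ∑ j, ((1 + γ * αR) * ‖step γ R f y j x - xs‖ ^ 2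
        + 2 * γ * realGap R f xs (step γ R f y j x)
        + (1 / 2 - γ * L) * ‖step γ R f y j x - x‖ ^ 2)
      ≤ (1 - γ * αF) * ‖x - xs‖ ^ 2 + 2 * γ ^ 2 * L ^ 2 * ‖x - y‖ ^ 2 := by
  have hm' : (0 : ℝ) < m := by exact_mod_cast hm
  rw [one_div, inv_mul_le_iff₀ hm']
  refine (Finset.sum_le_sum fun j _ => (step_inequality hR hlsc (differentiable_avg hf)
    (norm_gradient_avg_sub_le hm hf hL) hxs hγ hγL hRconv hFconv y j x).2).trans ?_
  rw [Finset.sum_add_distrib, Finset.sum_add_distrib, ← Finset.mul_sum, ← Finset.mul_sum,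
    ← Finset.mul_sum, ← sum_inner, sum_vrErr hm hf, inner_zero_left]
  simp only [Finset.sum_const, Finset.card_univ, Fintype.card_fin, nsmul_eq_mul]
  have := mul_le_mul_of_nonneg_left (sum_norm_vrErr_sq_le hm hf hL x y)
    (by positivity : 0 ≤ 2 * γ ^ 2)
  linarith

end Step

/-! ### Functions of finitely many samples -/

section Samples

variable {m : ℕ} {Ω : Type*} [mΩ : MeasurableSpace Ω] {s : ℕ → Ω → Fin m}

/-- The filtration whose `k`-th member is generated by the first `k` samples. -/
def sampleFiltration (s : ℕ → Ω → Fin m) (hs : ∀ k, Measurable (s k)) : Filtration ℕ mΩ where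
  seq k := MeasurableSpace.comap (fun ω (i : Finset.range k) => s i ω) MeasurableSpace.pi
  mono' := by
    intro k l hkl
    let r : (Finset.range l → Fin m) → (Finset.range k → Fin m) :=
      fun t i => t ⟨i, Finset.range_mono hkl i.2⟩
    have hr : Measurable r := measurable_pi_lambda _ fun i => measurable_pi_apply _
    have : (fun ω (i : Finset.range k) => s i ω) = r ∘ fun ω (i : Finset.range l) => s i ω := rfl
    simp only
    rw [this, ← MeasurableSpace.comap_comp]
    exact MeasurableSpace.comap_mono hr.comap_le
  le' k := (measurable_pi_lambda (fun ω (i : Finset.range k) => s i ω) fun i => hs i).comap_le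

/-- There are only finitely many k-tuples of samples, so anything factoring through them is
automatically measurable at time k and, if real-valued, integrable: no moment bounds are needed
below. -/
lemma DependsOn.exists_factor {β : Type*} [Nonempty β] {G : (ℕ → Fin m) → β} {k : ℕ}
    (hG : DependsOn G (Set.Iio k)) :
    ∃ h : (Finset.range k → Fin m) → β, ∀ σ, G σ = h fun i => σ i := by
  have hG' : DependsOn G (Finset.range k : Set ℕ) := by simpa using hG
  obtain ⟨h, hh⟩ := dependsOn_iff_exists_comp.1 hG'
  exact ⟨h, fun σ => congrFun hh σ⟩

lemma DependsOn.measurable_sample {β : Type*} [MeasurableSpace β] (hs : ∀ k, Measurable (s k))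
    {G : (ℕ → Fin m) → β} {k : ℕ} (hG : DependsOn G (Set.Iio k)) :
    Measurable[sampleFiltration s hs k] fun ω => G fun j => s j ω := by
  rcases isEmpty_or_nonempty β with hβ | hβ
  · have : IsEmpty Ω := ⟨fun ω => hβ.elim (G fun j => s j ω)⟩
    exact @measurable_of_empty _ _ (_) _ _ _
  obtain ⟨h, hh⟩ := DependsOn.exists_factor hG
  simp_rw [hh]
  exact (measurable_of_finite h).comp (comap_measurable _)

lemma DependsOn.integrable_sample {μ : Measure Ω} [IsFiniteMeasure μ] (hs : ∀ k, Measurable (s k))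
    {G : (ℕ → Fin m) → ℝ} {k : ℕ} (hG : DependsOn G (Set.Iio k)) :
    Integrable (fun ω => G fun j => s j ω) μ := by
  obtain ⟨h, hh⟩ := DependsOn.exists_factor hG
  simp_rw [hh]
  have hmeas : Measurable fun ω (i : Finset.range k) => s i ω :=
    measurable_pi_lambda _ fun i => hs i
  exact (Integrable.of_finite (μ := μ.map _) (f := h)).comp_measurable hmeas

/-- A function of the first `k` samples and of the uniformly distributed `k`-th sample is averaged
over the latter. -/
lemma setIntegral_sample {μ : Measure Ω} [IsProbabilityMeasure μ] (hs : ∀ k, Measurable (s k))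
    (hindep : iIndepFun s μ) (hunif : ∀ k j, μ {ω | s k ω = j} = (m : ℝ≥0∞)⁻¹)
    {k : ℕ} {G : Fin m → (ℕ → Fin m) → ℝ} (hG : ∀ j, DependsOn (G j) (Set.Iio k))
    {A : Set Ω} (hA : MeasurableSet[sampleFiltration s hs k] A) :
    ∫ ω in A, G (s k ω) (fun i => s i ω) ∂μ
      = ∫ ω in A, 1 / (m : ℝ) * ∑ j, G j (fun i => s i ω) ∂μ := by
  have hAm : MeasurableSet A := (sampleFiltration s hs).le k A hA
  have hind : ∀ j, IndepFun (fun ω => ({j} : Set (Fin m)).indicator (fun _ => (1 : ℝ)) (s k ω))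
      (A.indicator fun ω => G j fun i => s i ω) μ := by
    intro j
    have h1 := (hindep.indepFun_finset {k} (Finset.range k) (by simp) hs)
    -- The k-th sample is independent of the past, hence the event `s k = j` is independent of `G j`
    -- restricted to `A`.
    have h2 : Indep (MeasurableSpace.comap (s k) ⊤) (sampleFiltration s hs k) μ := by
      refine indep_of_indep_of_le_left h1 ?_
      have : s k = (fun t : (({k} : Finset ℕ) → Fin m) => t ⟨k, by simp⟩) ∘
          fun ω (i : ({k} : Finset ℕ)) => s i ω := rfl
      nth_rewrite 1 [this]
      rw [← MeasurableSpace.comap_comp]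
      exact MeasurableSpace.comap_mono (measurable_pi_apply _).comap_le
    refine indep_of_indep_of_le_left (indep_of_indep_of_le_right h2 ?_) ?_
    · exact (Measurable.indicator (DependsOn.measurable_sample hs (hG j)) hA).comap_le
    · have : (fun ω => ({j} : Set (Fin m)).indicator (fun _ => (1 : ℝ)) (s k ω))
          = ({j} : Set (Fin m)).indicator (fun _ => (1 : ℝ)) ∘ s k := rfl
      rw [this, ← MeasurableSpace.comap_comp]
      exact MeasurableSpace.comap_mono le_top
  have hint : ∀ j, Integrable (A.indicator fun ω => G j fun i => s i ω) μ := fun j =>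
    (DependsOn.integrable_sample hs (hG j)).indicator hAm
  have hind_meas : ∀ j, Measurable
      (fun ω => ({j} : Set (Fin m)).indicator (fun _ => (1 : ℝ)) (s k ω)) := fun j =>
    (measurable_of_finite (({j} : Set (Fin m)).indicator fun _ => (1 : ℝ))).comp (hs k)
  have hE : ∀ j, ∫ ω, ({j} : Set (Fin m)).indicator (fun _ => (1 : ℝ)) (s k ω) ∂μ
      = 1 / (m : ℝ) := by
    intro j
    have : (fun ω => ({j} : Set (Fin m)).indicator (fun _ => (1 : ℝ)) (s k ω))
        = {ω | s k ω = j}.indicator 1 := by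
      ext ω
      simp [Set.indicator_apply]
    have hjm : MeasurableSet {ω | s k ω = j} := hs k (measurableSet_singleton j)
    rw [this, integral_indicator_one hjm, measureReal_def, hunif]
    simp
  have hprod : ∀ j, Integrable (fun ω => ({j} : Set (Fin m)).indicator (fun _ => (1 : ℝ)) (s k ω)
      * A.indicator (fun ω => G j fun i => s i ω) ω) μ := by
    intro j
    refine (hint j).bdd_mul (c := 1) (hind_meas j).aestronglyMeasurable (ae_of_all _ fun ω => ?_)
    simp only [Set.indicator_apply]
    split_ifs <;> simp
  rw [← integral_indicator hAm, ← integral_indicator hAm]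
  -- Splitting over the values of `s k` freezes the first argument of `G`, so each summand is a
  -- product of independent factors.
  have e1 : (A.indicator fun ω => G (s k ω) fun i => s i ω) = fun ω =>
      ∑ j, ({j} : Set (Fin m)).indicator (fun _ => (1 : ℝ)) (s k ω)
        * A.indicator (fun ω => G j fun i => s i ω) ω := by
    ext ω
    by_cases hω : ω ∈ A <;> simp [Set.indicator_apply, hω]
  have e2 : (A.indicator fun ω => 1 / (m : ℝ) * ∑ j, G j fun i => s i ω) = fun ω =>
      ∑ j, 1 / (m : ℝ) * A.indicator (fun ω => G j fun i => s i ω) ω := by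
    ext ω
    by_cases hω : ω ∈ A <;> simp [hω, Finset.mul_sum]
  rw [e1, e2, integral_finsetSum _ fun j _ => hprod j,
    integral_finsetSum _ fun j _ => (hint j).const_mul _]
  refine Finset.sum_congr rfl fun j _ => ?_
  rw [(hind j).integral_fun_mul_eq_mul_integral (hind_meas j).aestronglyMeasurable
    (hint j).aestronglyMeasurable, hE, integral_const_mul]

/-- Nonnegative functions with bounded partial sums of integrals are almost surely summable. -/
lemma ae_summable_of_sum_integral_le {μ : Measure Ω} {g : ℕ → Ω → ℝ}
    (hg : ∀ k, Integrable (g k) μ) (hpos : ∀ k ω, 0 ≤ g k ω) {B : ℝ}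
    (hB : ∀ N, ∑ k ∈ Finset.range N, ∫ ω, g k ω ∂μ ≤ B) :
    ∀ᵐ ω ∂μ, Summable fun k => g k ω := by
  have h1 : ∫⁻ ω, ∑' k, ENNReal.ofReal (g k ω) ∂μ ≤ ENNReal.ofReal B := by
    rw [lintegral_tsum fun k => (hg k).aestronglyMeasurable.aemeasurable.ennreal_ofReal]
    refine ENNReal.tsum_le_of_sum_range_le fun N => ?_
    simp_rw [← ofReal_integral_eq_lintegral_ofReal (hg _) (ae_of_all _ (hpos _))]
    rw [← ENNReal.ofReal_sum_of_nonneg fun k _ => integral_nonneg (hpos k)]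
    exact ENNReal.ofReal_le_ofReal (hB N)
  have h2 := ae_lt_top' (AEMeasurable.tsum fun k =>
    (hg k).aestronglyMeasurable.aemeasurable.ennreal_ofReal)
    (h1.trans_lt ENNReal.ofReal_lt_top).ne
  filter_upwards [h2] with ω hω
  have := ENNReal.summable_toReal hω.ne
  simpa [ENNReal.toReal_ofReal (hpos _ _)] using this

end Samples

/-! ### Trajectories with periodically updated reference points -/

section Epoch

variable {V : Type*} [NormedAddCommGroup V]

/-- The sum of the squared steps of the trajectory `u` since the last reference point. -/
def stepSum (P : ℕ) (u : ℕ → V) (k : ℕ) : ℝ :=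
  ∑ i ∈ Finset.Ico (k / P * P) k, ‖u (i + 1) - u i‖ ^ 2

lemma stepSum_nonneg (P : ℕ) (u : ℕ → V) (k : ℕ) : 0 ≤ stepSum P u k :=
  Finset.sum_nonneg fun _ _ => sq_nonneg _

/-- Telescoping and Cauchy–Schwarz over at most `P` steps of the epoch. -/
lemma norm_sub_ref_sq_le {P : ℕ} (hP : 0 < P) (u : ℕ → V) (k : ℕ) :
    ‖u k - u (k / P * P)‖ ^ 2 ≤ P * stepSum P u k := by
  have hle : k / P * P ≤ k := Nat.div_mul_le_self k P
  rw [← Finset.sum_Ico_sub u hle]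
  calc ‖∑ i ∈ Finset.Ico (k / P * P) k, (u (i + 1) - u i)‖ ^ 2
      ≤ (∑ i ∈ Finset.Ico (k / P * P) k, ‖u (i + 1) - u i‖) ^ 2 :=
        pow_le_pow_left₀ (norm_nonneg _) (norm_sum_le _ _) 2
    _ ≤ (Finset.Ico (k / P * P) k).card * stepSum P u k := sq_sum_le_card_mul_sum_sq
    _ ≤ P * stepSum P u k := by
        refine mul_le_mul_of_nonneg_right ?_ (stepSum_nonneg P u k)
        have h1 := Nat.div_add_mod' k P
        have h2 := Nat.mod_lt k hP
        rw [Nat.card_Ico]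
        exact_mod_cast (by omega : k - k / P * P ≤ P)

lemma stepSum_mul_self {P : ℕ} (hP : 0 < P) (u : ℕ → V) (l : ℕ) : stepSum P u (l * P) = 0 := by
  simp [stepSum, Nat.mul_div_cancel _ hP]

/-- The reset of `stepSum` at the end of an epoch is harmless after weighting by the number of
remaining steps. -/
lemma weighted_stepSum_succ_le {P : ℕ} (hP : 0 < P) (u : ℕ → V) (k : ℕ) :
    ((P : ℝ) - ((k + 1) % P : ℕ)) * stepSum P u (k + 1)
      ≤ ((P : ℝ) - (k % P : ℕ) - 1) * (stepSum P u k + ‖u (k + 1) - u k‖ ^ 2) := by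
  have hlt := Nat.mod_lt k hP
  have hdm := Nat.div_add_mod' k P
  rcases Nat.lt_or_ge (k % P + 1) P with h | h
  · have h1 : (k + 1) / P = k / P := by
      rw [Nat.div_eq_iff hP]
      have h2 : (k / P + 1) * P = k / P * P + P := by ring
      omega
    have h2 : (k + 1) % P = k % P + 1 := by
      have := Nat.div_add_mod' (k + 1) P
      rw [h1] at this
      omega
    rw [stepSum, h1, h2, Finset.sum_Ico_succ_top (Nat.div_mul_le_self k P), ← stepSum]
    push_cast
    rw [sub_sub]
  · have h1 : k + 1 = (k / P + 1) * P := by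
      have : (k / P + 1) * P = k / P * P + P := by ring
      omega
    have h2 : stepSum P u (k + 1) = 0 := by rw [h1, stepSum_mul_self hP]
    rw [h2, mul_zero]
    refine mul_nonneg ?_ (add_nonneg (stepSum_nonneg P u k) (sq_nonneg _))
    have : ((k % P : ℕ) : ℝ) + 1 ≤ P := by exact_mod_cast hlt
    linarith

/-- A difference of two partial sums of a convergent series, both indices tending to infinity. -/
lemma tendsto_stepSum {P : ℕ} (hP : 0 < P) {u : ℕ → V}
    (hu : Summable fun k => ‖u (k + 1) - u k‖ ^ 2) :
    Tendsto (stepSum P u) atTop (𝓝 0) := by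
  have h1 := hu.hasSum.tendsto_sum_nat
  have h2 : Tendsto (fun k => k / P * P) atTop atTop :=
    (Nat.tendsto_div_const_atTop hP.ne').atTop_mul_const' hP
  have h3 := h1.sub (h1.comp h2)
  rw [sub_self] at h3
  refine h3.congr fun k => ?_
  rw [stepSum, Finset.sum_Ico_eq_sub _ (Nat.div_mul_le_self k P)]
  rfl

lemma tendsto_sub_ref {P : ℕ} (hP : 0 < P) {u : ℕ → V}
    (hu : Summable fun k => ‖u (k + 1) - u k‖ ^ 2) :
    Tendsto (fun k => ‖u k - u (k / P * P)‖) atTop (𝓝 0) := by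
  have h1 : Tendsto (fun k => ‖u k - u (k / P * P)‖ ^ 2) atTop (𝓝 0) := by
    refine squeeze_zero (fun k => sq_nonneg _) (norm_sub_ref_sq_le hP u) ?_
    simpa using (tendsto_stepSum hP hu).const_mul (P : ℝ)
  simpa using h1.sqrt

/-- The Lyapunov function of the trajectory `u`. -/
noncomputable def energy (P : ℕ) (a κ : ℝ) (xs : V) (u : ℕ → V) (k : ℕ) : ℝ :=
  a * ‖u k - xs‖ ^ 2 + κ * (((P : ℝ) - (k % P : ℕ)) * stepSum P u k)

lemma weight_nonneg {P : ℕ} (hP : 0 < P) (k : ℕ) : 0 ≤ (P : ℝ) - (k % P : ℕ) := by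
  have : ((k % P : ℕ) : ℝ) ≤ P := by exact_mod_cast (Nat.mod_lt k hP).le
  linarith

lemma energy_nonneg {P : ℕ} (hP : 0 < P) {a κ : ℝ} (ha : 0 ≤ a) (hκ : 0 ≤ κ) (xs : V)
    (u : ℕ → V) (k : ℕ) : 0 ≤ energy P a κ xs u k :=
  add_nonneg (mul_nonneg ha (sq_nonneg _))
    (mul_nonneg hκ (mul_nonneg (weight_nonneg hP k) (stepSum_nonneg P u k)))

lemma energy_mul_self {P : ℕ} (hP : 0 < P) (a κ : ℝ) (xs : V) (u : ℕ → V) (l : ℕ) :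
    energy P a κ xs u (l * P) = a * ‖u (l * P) - xs‖ ^ 2 := by
  rw [energy, stepSum_mul_self hP, mul_zero, mul_zero, add_zero]

lemma energy_mono {P : ℕ} {a b : ℝ} (hab : a ≤ b) (κ : ℝ) (xs : V) (u : ℕ → V) (k : ℕ) :
    energy P a κ xs u k ≤ energy P b κ xs u k :=
  add_le_add_left (mul_le_mul_of_nonneg_right hab (sq_nonneg _)) _

/-- The history term of the energy is at most a constant times `stepSum`, which tends to 0, so the
distance term alone must converge. -/
lemma tendsto_norm_sub_of_tendsto_energy {P : ℕ} (hP : 0 < P) {κ : ℝ} {xs : V} {u : ℕ → V}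
    (hu : Summable fun k => ‖u (k + 1) - u k‖ ^ 2) {w : ℝ}
    (hw : Tendsto (energy P 1 κ xs u) atTop (𝓝 w)) :
    ∃ d, Tendsto (fun k => ‖u k - xs‖) atTop (𝓝 d) := by
  have h1 : Tendsto (fun k => ((P : ℝ) - (k % P : ℕ)) * stepSum P u k) atTop (𝓝 0) := by
    refine squeeze_zero (fun k => mul_nonneg (weight_nonneg hP k) (stepSum_nonneg P u k))
      (fun k => ?_) (by simpa using (tendsto_stepSum hP hu).const_mul (P : ℝ))
    exact mul_le_mul_of_nonneg_right (by simp) (stepSum_nonneg P u k)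
  have h2 := (hw.sub (h1.const_mul κ)).sqrt
  refine ⟨_, h2.congr fun k => ?_⟩
  rw [energy, add_sub_cancel_right, one_mul, Real.sqrt_sq (norm_nonneg _)]

lemma dependsOn_stepSum (P k : ℕ) :
    DependsOn (fun u : ℕ → V => stepSum P u k) (Set.Iic k) := by
  intro u v h
  refine Finset.sum_congr rfl fun i hi => ?_
  have hi := (Finset.mem_Ico.1 hi).2
  rw [h i (Set.mem_Iic.2 hi.le), h (i + 1) (Set.mem_Iic.2 hi)]

lemma dependsOn_energy (P k : ℕ) (a κ : ℝ) (xs : V) :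
    DependsOn (fun u : ℕ → V => energy P a κ xs u k) (Set.Iic k) := by
  intro u v h
  have h1 := dependsOn_stepSum P k h
  simp only at h1
  simp only [energy, h k (Set.mem_Iic.2 le_rfl), h1]

end Epoch

/-! ### Randomly driven trajectories -/

section Trajectory

variable {m : ℕ} {V : Type*}

/-- `x σ` is the trajectory driven by the samples `σ` through the step map `T`, whose first argument
is the reference point, updated every `P` steps. -/
structure IsEpochProcess (P : ℕ) (T : V → Fin m → V → V) (x0 : V)
    (x : (ℕ → Fin m) → ℕ → V) : Prop where
  zero : ∀ σ, x σ 0 = x0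
  succ : ∀ σ k, x σ (k + 1) = T (x σ (k / P * P)) (σ k) (x σ k)

variable {P : ℕ} {T : V → Fin m → V → V} {x0 : V} {x : (ℕ → Fin m) → ℕ → V}

/-- Strong induction, since a step also reads the reference point, which may lie up to `P - 1`
indices back. -/
lemma IsEpochProcess.dependsOn (hx : IsEpochProcess P T x0 x) (k : ℕ) :
    DependsOn (fun σ => x σ k) (Set.Iio k) := by
  induction k using Nat.strong_induction_on with
  | _ k ih =>
    intro σ τ h
    cases k with
    | zero => simp only [hx.zero]
    | succ k =>
      have h1 : ∀ i ≤ k, x σ i = x τ i := fun i hi =>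
        ih i (Nat.lt_succ_of_le hi) fun j hj =>
          h j (Set.mem_Iio.2 ((Set.mem_Iio.1 hj).trans_le (hi.trans k.le_succ)))
      simp only [hx.succ, h1 k le_rfl, h1 _ (Nat.div_mul_le_self k P),
        h k (Set.mem_Iio.2 k.lt_succ_self)]

lemma IsEpochProcess.dependsOn_comp (hx : IsEpochProcess P T x0 x) {β : Type*}
    {Ψ : (ℕ → V) → β} {k : ℕ} (hΨ : DependsOn Ψ (Set.Iic k)) :
    DependsOn (fun σ => Ψ (x σ)) (Set.Iio k) := by
  intro σ τ h
  exact hΨ fun i hi => hx.dependsOn i fun j hj =>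
    h j (Set.mem_Iio.2 (lt_of_lt_of_le (Set.mem_Iio.1 hj) (Set.mem_Iic.1 hi)))

variable {Ω : Type*} [MeasurableSpace Ω] {μ : Measure Ω} [IsProbabilityMeasure μ]
  {s : ℕ → Ω → Fin m}

lemma IsEpochProcess.integrable (hx : IsEpochProcess P T x0 x) (hs : ∀ k, Measurable (s k))
    {Ψ : (ℕ → V) → ℝ} {k : ℕ} (hΨ : DependsOn Ψ (Set.Iic k)) :
    Integrable (fun ω => Ψ (x fun j => s j ω)) μ :=
  DependsOn.integrable_sample hs (hx.dependsOn_comp hΨ)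

variable [NormedAddCommGroup V]

/-- The mean decrease of the energy along an epoch process whose step map satisfies a mean energy
inequality. -/
lemma IsEpochProcess.setIntegral_energy_succ_le (hx : IsEpochProcess P T x0 x) (hP : 0 < P)
    (hs : ∀ k, Measurable (s k)) (hindep : iIndepFun s μ)
    (hunif : ∀ k j, μ {ω | s k ω = j} = (m : ℝ≥0∞)⁻¹)
    {a b c c' κ : ℝ} (hκ : 0 ≤ κ) (hc : κ * P ^ 2 + c' ≤ c) {xs : V} {g : V → ℝ}
    (hT : ∀ y z, 1 / (m : ℝ) * ∑ j, (a * ‖T y j z - xs‖ ^ 2 + g (T y j z)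
      + c * ‖T y j z - z‖ ^ 2) ≤ b * ‖z - xs‖ ^ 2 + κ * ‖z - y‖ ^ 2)
    (k : ℕ) {A : Set Ω} (hA : MeasurableSet[sampleFiltration s hs k] A) :
    ∫ ω in A, energy P a (κ * P) xs (x fun j => s j ω) (k + 1) ∂μ
      + ∫ ω in A, (g (x (fun j => s j ω) (k + 1))
        + c' * ‖x (fun j => s j ω) (k + 1) - x (fun j => s j ω) k‖ ^ 2) ∂μ
      ≤ ∫ ω in A, energy P b (κ * P) xs (x fun j => s j ω) k ∂μ := by
  have hle : ∀ {i l : ℕ}, i ≤ l → i ∈ Set.Iic l := fun h => h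
  have hd0 : DependsOn (fun u : ℕ → V => κ * ((P : ℝ) * (((P : ℝ) - (k % P : ℕ) - 1)
      * (stepSum P u k)))) (Set.Iic k) := by
    intro u v h
    have := dependsOn_stepSum P k h
    simp only at this ⊢
    rw [this]
  have hd1 : DependsOn (fun u : ℕ → V => a * ‖u (k + 1) - xs‖ ^ 2 + g (u (k + 1))
      + c * ‖u (k + 1) - u k‖ ^ 2) (Set.Iic (k + 1)) := by
    intro u v h
    simp only [h k (hle k.le_succ), h (k + 1) (hle le_rfl)]
  have hd2 : DependsOn (fun u : ℕ → V => b * ‖u k - xs‖ ^ 2 + κ * ‖u k - u (k / P * P)‖ ^ 2)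
      (Set.Iic k) := by
    intro u v h
    simp only [h k (hle le_rfl), h _ (hle (Nat.div_mul_le_self k P))]
  have hd3 : DependsOn (fun u : ℕ → V => g (u (k + 1)) + c' * ‖u (k + 1) - u k‖ ^ 2)
      (Set.Iic (k + 1)) := by
    intro u v h
    simp only [h k (hle k.le_succ), h (k + 1) (hle le_rfl)]
  have hi0 := (hx.integrable (μ := μ) hs hd0).integrableOn (s := A)
  have hi1 := (hx.integrable (μ := μ) hs hd1).integrableOn (s := A)
  have hi2 := (hx.integrable (μ := μ) hs hd2).integrableOn (s := A)
  have hi3 := (hx.integrable (μ := μ) hs hd3).integrableOn (s := A)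
  have hi4 := (hx.integrable (μ := μ) hs (dependsOn_energy P (k + 1) a (κ * P) xs)).integrableOn
    (s := A)
  have hi5 := (hx.integrable (μ := μ) hs (dependsOn_energy P k b (κ * P) xs)).integrableOn (s := A)
  have hP0 : (0 : ℝ) ≤ P := Nat.cast_nonneg P
  have hmean : ∫ ω in A, (a * ‖x (fun j => s j ω) (k + 1) - xs‖ ^ 2 + g (x (fun j => s j ω) (k + 1))
      + c * ‖x (fun j => s j ω) (k + 1) - x (fun j => s j ω) k‖ ^ 2) ∂μ
      ≤ ∫ ω in A, (b * ‖x (fun j => s j ω) k - xs‖ ^ 2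
        + κ * ‖x (fun j => s j ω) k - x (fun j => s j ω) (k / P * P)‖ ^ 2) ∂μ := by
    have hG : ∀ j, DependsOn (fun σ => a * ‖T (x σ (k / P * P)) j (x σ k) - xs‖ ^ 2
        + g (T (x σ (k / P * P)) j (x σ k)) + c * ‖T (x σ (k / P * P)) j (x σ k) - x σ k‖ ^ 2)
        (Set.Iio k) := by
      intro j
      refine hx.dependsOn_comp (Ψ := fun u => a * ‖T (u (k / P * P)) j (u k) - xs‖ ^ 2
        + g (T (u (k / P * P)) j (u k)) + c * ‖T (u (k / P * P)) j (u k) - u k‖ ^ 2) ?_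
      intro u v h
      simp only [h k (hle le_rfl), h _ (hle (Nat.div_mul_le_self k P))]
    have h1 := setIntegral_sample (μ := μ) hs hindep hunif hG hA
    have h2 : ∀ ω, a * ‖x (fun j => s j ω) (k + 1) - xs‖ ^ 2 + g (x (fun j => s j ω) (k + 1))
        + c * ‖x (fun j => s j ω) (k + 1) - x (fun j => s j ω) k‖ ^ 2
        = a * ‖T (x (fun i => s i ω) (k / P * P)) (s k ω) (x (fun i => s i ω) k) - xs‖ ^ 2
        + g (T (x (fun i => s i ω) (k / P * P)) (s k ω) (x (fun i => s i ω) k))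
        + c * ‖T (x (fun i => s i ω) (k / P * P)) (s k ω) (x (fun i => s i ω) k)
          - x (fun i => s i ω) k‖ ^ 2 := fun ω => by rw [hx.succ]
    simp_rw [h2]
    rw [h1]
    refine integral_mono ?_ hi2 fun ω => hT _ _
    refine (Integrable.const_mul (integrable_finsetSum _ fun j _ => ?_) _).integrableOn
    exact DependsOn.integrable_sample hs (hG j)
  -- The history that survives the step, with weight lowered by one, is added to both sides of
  -- `hmean`. Here the cost κP² of the new step is absorbed in c, leaving c'.
  have hup : ∫ ω in A, energy P a (κ * P) xs (x fun j => s j ω) (k + 1) ∂μ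
      + ∫ ω in A, (g (x (fun j => s j ω) (k + 1))
        + c' * ‖x (fun j => s j ω) (k + 1) - x (fun j => s j ω) k‖ ^ 2) ∂μ
      ≤ ∫ ω in A, (a * ‖x (fun j => s j ω) (k + 1) - xs‖ ^ 2 + g (x (fun j => s j ω) (k + 1))
      + c * ‖x (fun j => s j ω) (k + 1) - x (fun j => s j ω) k‖ ^ 2) ∂μ
      + ∫ ω in A, κ * ((P : ℝ) * (((P : ℝ) - (k % P : ℕ) - 1)
      * (stepSum P (x fun j => s j ω) k))) ∂μ := by
    rw [← integral_add hi4 hi3, ← integral_add hi1 hi0]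
    refine integral_mono (hi4.add hi3) (hi1.add hi0) fun ω => ?_
    simp only [energy]
    set u := x fun j => s j ω
    have h1 := mul_le_mul_of_nonneg_left (weighted_stepSum_succ_le hP u k) (mul_nonneg hκ hP0)
    have h2 : κ * P * (((P : ℝ) - (k % P : ℕ) - 1) * ‖u (k + 1) - u k‖ ^ 2)
        ≤ κ * P * (P * ‖u (k + 1) - u k‖ ^ 2) := by
      refine mul_le_mul_of_nonneg_left (mul_le_mul_of_nonneg_right ?_ (sq_nonneg _))
        (mul_nonneg hκ hP0)
      have : (0 : ℝ) ≤ (k % P : ℕ) := Nat.cast_nonneg _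
      linarith
    have h3 := mul_le_mul_of_nonneg_right hc (sq_nonneg ‖u (k + 1) - u k‖)
    linarith
  -- The variance costs at most κP times `stepSum`, exactly one unit of the weight; with the
  -- surviving history it makes up the energy at `k`.
  have hdown : ∫ ω in A, (b * ‖x (fun j => s j ω) k - xs‖ ^ 2
        + κ * ‖x (fun j => s j ω) k - x (fun j => s j ω) (k / P * P)‖ ^ 2) ∂μ
      + ∫ ω in A, κ * ((P : ℝ) * (((P : ℝ) - (k % P : ℕ) - 1)
      * (stepSum P (x fun j => s j ω) k))) ∂μ
      ≤ ∫ ω in A, energy P b (κ * P) xs (x fun j => s j ω) k ∂μ := by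
    rw [← integral_add hi2 hi0]
    refine integral_mono (hi2.add hi0) hi5 fun ω => ?_
    simp only [energy]
    have h1 := mul_le_mul_of_nonneg_left (norm_sub_ref_sq_le hP (x fun j => s j ω) k) hκ
    linarith
  linarith

/-- The partial sums of the mean decrease are bounded by the initial energy. -/
lemma IsEpochProcess.sum_integral_le (hx : IsEpochProcess P T x0 x) (hP : 0 < P)
    (hs : ∀ k, Measurable (s k)) (hindep : iIndepFun s μ)
    (hunif : ∀ k j, μ {ω | s k ω = j} = (m : ℝ≥0∞)⁻¹)
    {c c' κ : ℝ} (hκ : 0 ≤ κ) (hc : κ * P ^ 2 + c' ≤ c) {xs : V} {g : V → ℝ}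
    (hT : ∀ y z, 1 / (m : ℝ) * ∑ j, (1 * ‖T y j z - xs‖ ^ 2 + g (T y j z)
      + c * ‖T y j z - z‖ ^ 2) ≤ 1 * ‖z - xs‖ ^ 2 + κ * ‖z - y‖ ^ 2) (N : ℕ) :
    ∑ k ∈ Finset.range N, ∫ ω, (g (x (fun j => s j ω) (k + 1))
        + c' * ‖x (fun j => s j ω) (k + 1) - x (fun j => s j ω) k‖ ^ 2) ∂μ
      + ∫ ω, energy P 1 (κ * P) xs (x fun j => s j ω) N ∂μ ≤ ‖x0 - xs‖ ^ 2 := by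
  induction N with
  | zero =>
    have h0 : ∀ ω, energy P 1 (κ * P) xs (x fun j => s j ω) 0 = ‖x0 - xs‖ ^ 2 := by
      intro ω
      have := energy_mul_self hP 1 (κ * P) xs (x fun j => s j ω) 0
      rwa [zero_mul, hx.zero, one_mul] at this
    simp [h0]
  | succ N ih =>
    have := hx.setIntegral_energy_succ_le hP hs hindep hunif hκ hc hT N MeasurableSet.univ
    simp only [Measure.restrict_univ] at this
    rw [Finset.sum_range_succ]
    linarith

/-- Almost sure convergence of the distance to `xs`, and summability of the decrease. -/
lemma IsEpochProcess.ae_tendsto (hx : IsEpochProcess P T x0 x) (hP : 0 < P)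
    (hs : ∀ k, Measurable (s k)) (hindep : iIndepFun s μ)
    (hunif : ∀ k j, μ {ω | s k ω = j} = (m : ℝ≥0∞)⁻¹)
    {c c' κ : ℝ} (hκ : 0 ≤ κ) (hc' : 0 < c') (hc : κ * P ^ 2 + c' ≤ c) {xs : V} {g : V → ℝ}
    (hT : ∀ y z, 1 / (m : ℝ) * ∑ j, (1 * ‖T y j z - xs‖ ^ 2 + g (T y j z)
      + c * ‖T y j z - z‖ ^ 2) ≤ 1 * ‖z - xs‖ ^ 2 + κ * ‖z - y‖ ^ 2)
    (hg : ∀ y j z, 0 ≤ g (T y j z)) :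
    ∀ᵐ ω ∂μ, (∃ d, Tendsto (fun k => ‖x (fun j => s j ω) k - xs‖) atTop (𝓝 d)) ∧
      Summable (fun k => ‖x (fun j => s j ω) (k + 1) - x (fun j => s j ω) k‖ ^ 2) ∧
      Tendsto (fun k => g (x (fun j => s j ω) (k + 1))) atTop (𝓝 0) := by
  have hκP : 0 ≤ κ * P := mul_nonneg hκ (Nat.cast_nonneg P)
  have hg' : ∀ σ k, 0 ≤ g (x σ (k + 1)) := fun σ k => by rw [hx.succ]; exact hg _ _ _
  have hd : ∀ k, DependsOn (fun u : ℕ → V => g (u (k + 1)) + c' * ‖u (k + 1) - u k‖ ^ 2)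
      (Set.Iic (k + 1)) := by
    intro k u v h
    simp only [h k (Set.mem_Iic.2 k.le_succ), h (k + 1) (Set.mem_Iic.2 le_rfl)]
  have hpos : ∀ k ω, 0 ≤ g (x (fun j => s j ω) (k + 1))
      + c' * ‖x (fun j => s j ω) (k + 1) - x (fun j => s j ω) k‖ ^ 2 := fun k ω =>
    add_nonneg (hg' _ _) (mul_nonneg hc'.le (sq_nonneg _))
  have hE : ∀ k, Integrable (fun ω => energy P 1 (κ * P) xs (x fun j => s j ω) k) μ := fun k =>
    hx.integrable hs (dependsOn_energy P k 1 (κ * P) xs)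
  have hEpos : ∀ k ω, 0 ≤ energy P 1 (κ * P) xs (x fun j => s j ω) k := fun k ω =>
    energy_nonneg hP zero_le_one hκP _ _ _
  have hsum := ae_summable_of_sum_integral_le (μ := μ) (B := ‖x0 - xs‖ ^ 2)
    (fun k => hx.integrable hs (hd k)) hpos fun N => by
      have h1 := hx.sum_integral_le hP hs hindep hunif hκ hc hT N
      have h2 : 0 ≤ ∫ ω, energy P 1 (κ * P) xs (x fun j => s j ω) N ∂μ :=
        integral_nonneg (hEpos N)
      linarith
  have hsuper : Supermartingale (fun k ω => energy P 1 (κ * P) xs (x fun j => s j ω) k)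
      (sampleFiltration s hs) μ := by
    refine supermartingale_of_setIntegral_succ_le (fun k => ?_) hE fun k A hA => ?_
    · exact (DependsOn.measurable_sample hs
        (hx.dependsOn_comp (dependsOn_energy P k 1 (κ * P) xs))).stronglyMeasurable
    · have h1 := hx.setIntegral_energy_succ_le hP hs hindep hunif hκ hc hT k hA
      have h2 : 0 ≤ ∫ ω in A, (g (x (fun j => s j ω) (k + 1))
        + c' * ‖x (fun j => s j ω) (k + 1) - x (fun j => s j ω) k‖ ^ 2) ∂μ :=
        integral_nonneg (hpos k)
      linarith
  -- Doob's convergence theorem for the submartingale `-energy`, whose L¹ norms are bounded by the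
  -- initial squared distance because the energy is nonnegative.
  have hconv := hsuper.neg.ae_tendsto_limitProcess (R := (‖x0 - xs‖ ^ 2).toNNReal) fun k => by
    rw [Pi.neg_apply, eLpNorm_neg, eLpNorm_one_eq_lintegral_enorm]
    simp_rw [Real.enorm_of_nonneg (hEpos k _)]
    rw [← ofReal_integral_eq_lintegral_ofReal (hE k) (ae_of_all _ (hEpos k))]
    refine ENNReal.ofReal_le_ofReal ?_
    have h1 := hx.sum_integral_le hP hs hindep hunif hκ hc hT k
    have h2 : 0 ≤ ∑ k ∈ Finset.range k, ∫ ω, (g (x (fun j => s j ω) (k + 1))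
        + c' * ‖x (fun j => s j ω) (k + 1) - x (fun j => s j ω) k‖ ^ 2) ∂μ :=
      Finset.sum_nonneg fun i _ => integral_nonneg (hpos i)
    linarith
  filter_upwards [hsum, hconv] with ω h1 h2
  have h3 : Summable (fun k => ‖x (fun j => s j ω) (k + 1) - x (fun j => s j ω) k‖ ^ 2) := by
    refine (summable_mul_left_iff hc'.ne').1 (Summable.of_nonneg_of_le
      (fun k => mul_nonneg hc'.le (sq_nonneg _)) (fun k => ?_) h1)
    linarith [hg' (fun j => s j ω) k]
  refine ⟨?_, h3, ?_⟩
  · have h4 := h2.neg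
    simp only [Pi.neg_apply, neg_neg] at h4
    exact tendsto_norm_sub_of_tendsto_energy hP h3 h4
  · refine squeeze_zero (fun k => hg' _ k) (fun k => ?_) h1.tendsto_atTop_zero
    have := mul_nonneg hc'.le (sq_nonneg ‖x (fun j => s j ω) (k + 1) - x (fun j => s j ω) k‖)
    linarith

/-- Contraction over one epoch under a strong mean energy inequality. -/
lemma IsEpochProcess.integral_epoch_le (hx : IsEpochProcess P T x0 x) (hP : 0 < P)
    (hs : ∀ k, Measurable (s k)) (hindep : iIndepFun s μ)
    (hunif : ∀ k j, μ {ω | s k ω = j} = (m : ℝ≥0∞)⁻¹)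
    {a b c κ : ℝ} (hba : b ≤ a) (hκ : 0 ≤ κ) (hc : κ * P ^ 2 ≤ c) {xs : V} {g : V → ℝ}
    (hT : ∀ y z, 1 / (m : ℝ) * ∑ j, (a * ‖T y j z - xs‖ ^ 2 + g (T y j z)
      + c * ‖T y j z - z‖ ^ 2) ≤ b * ‖z - xs‖ ^ 2 + κ * ‖z - y‖ ^ 2)
    (hg : ∀ y j z, 0 ≤ g (T y j z)) (l : ℕ) :
    a * ∫ ω, ‖x (fun j => s j ω) ((l + 1) * P) - xs‖ ^ 2 ∂μ
      ≤ b * ∫ ω, ‖x (fun j => s j ω) (l * P) - xs‖ ^ 2 ∂μ := by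
  have hstep : ∀ k, ∫ ω, energy P a (κ * P) xs (x fun j => s j ω) (k + 1) ∂μ
      ≤ ∫ ω, energy P b (κ * P) xs (x fun j => s j ω) k ∂μ := by
    intro k
    have h1 := hx.setIntegral_energy_succ_le (c' := 0) hP hs hindep hunif hκ (by linarith) hT k
      MeasurableSet.univ
    simp only [Measure.restrict_univ, zero_mul, add_zero] at h1
    have h2 : 0 ≤ ∫ ω, g (x (fun j => s j ω) (k + 1)) ∂μ :=
      integral_nonneg fun ω => by
        simp only [Pi.zero_apply]
        rw [hx.succ]
        exact hg _ _ _
    linarith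
  have key : ∀ p, ∫ ω, energy P a (κ * P) xs (x fun j => s j ω) (l * P + p + 1) ∂μ
      ≤ ∫ ω, energy P b (κ * P) xs (x fun j => s j ω) (l * P) ∂μ := by
    intro p
    induction p with
    | zero => exact hstep _
    | succ p ih =>
      -- The factor b/a is gained only once per epoch: at inner steps `b ≤ a` is used merely to
      -- chain the inequalities.
      refine (hstep _).trans (le_trans ?_ ih)
      exact integral_mono (hx.integrable hs (dependsOn_energy P _ b (κ * P) xs))
        (hx.integrable hs (dependsOn_energy P _ a (κ * P) xs)) fun ω => energy_mono hba _ _ _ _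
  -- `key p` covers p + 1 steps, so p = P - 1 reaches the next reference point, where the history
  -- term is zero.
  have h1 := key (P - 1)
  have h2 : l * P + (P - 1) + 1 = (l + 1) * P := by
    rw [add_mul, one_mul]
    omega
  rw [h2] at h1
  simp_rw [energy_mul_self hP] at h1
  rwa [integral_const_mul, integral_const_mul] at h1

end Trajectory

/-! ### Prox-SVRG as an epoch process -/

section Algorithm

variable {n m : ℕ} {γ : ℝ} {P : ℕ} {R : Vec n → EReal} {f : Fin m → Vec n → ℝ} {x0 : Vec n}

lemma iter_mul_self (hP : 0 < P) (s : ℕ → Fin m) (l : ℕ) :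
    iter γ P R f x0 s (l * P) = outer γ P R f x0 s l := by
  simp [iter, Nat.mul_div_cancel _ hP, inner]

lemma isEpochProcess_iter (hP : 0 < P) :
    IsEpochProcess P (step γ R f) x0 (iter γ P R f x0) where
  zero s := by simp [iter, outer, inner]
  succ s k := by
    have hlt := Nat.mod_lt k hP
    have hdm := Nat.div_add_mod' k P
    rw [iter_mul_self hP]
    have hinner : step γ R f (outer γ P R f x0 s (k / P)) (s k) (iter γ P R f x0 s k)
        = inner γ R f (outer γ P R f x0 s (k / P)) (fun p => s (k / P * P + p)) (k % P + 1) := by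
      rw [inner, hdm]
      rfl
    rw [hinner]
    rcases Nat.lt_or_ge (k % P + 1) P with h | h
    · have h1 : (k + 1) / P = k / P := by
        rw [Nat.div_eq_iff hP]
        have h2 : (k / P + 1) * P = k / P * P + P := by ring
        omega
      have h2 : (k + 1) % P = k % P + 1 := by
        have := Nat.div_add_mod' (k + 1) P
        rw [h1] at this
        omega
      rw [iter, h1, h2]
    · have h1 : k + 1 = (k / P + 1) * P := by
        have : (k / P + 1) * P = k / P * P + P := by ring
        omega
      rw [h1, iter_mul_self hP, outer, (by omega : k % P + 1 = P)]

lemma err_eq_vrErr (hP : 0 < P) (s : ℕ → Fin m) (k : ℕ) :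
    err γ P R f x0 s k
      = vrErr f (iter γ P R f x0 s (k / P * P)) (s k) (iter γ P R f x0 s k) := by
  rw [iter_mul_self hP, err, vrErr]

end Algorithm

/-! ### The gap of the ergodic average -/

section Ergodic

variable {n m : ℕ} {R : Vec n → EReal} {f : Fin m → Vec n → ℝ}

/-- Jensen's inequality on the domain of `R`. The average starts at index 1, so `R (u 0)` may be
infinite. -/
lemma gap_average_le (hR : Proper R) (hconv : ConvexFun R)
    (hF : ConvexOn ℝ Set.univ (avg f)) {xs : Vec n} (hxs : xs ∈ Argmin (objective R f))
    {u : ℕ → Vec n} (hu : ∀ k, R (u (k + 1)) ≠ ⊤) {k : ℕ} (hk : 0 < k) :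
    gap (objective R f) xs ((1 / (k : ℝ)) • ∑ j ∈ Finset.Icc 1 k, u j)
      ≤ ENNReal.ofReal (1 / (k : ℝ) * ∑ i ∈ Finset.range k, realGap R f xs (u (i + 1))) := by
  have hk' : (0 : ℝ) < k := by exact_mod_cast hk
  have hsum : ∑ j ∈ Finset.Icc 1 k, u j = ∑ i ∈ Finset.range k, u (i + 1) := by
    rw [Finset.range_eq_Ico, Finset.sum_Ico_add' u 0 k 1]
    rfl
  have hc : ConvexOn ℝ {x | R x ≠ ⊤} (realGap R f xs) := by
    have h1 := ConvexFun.convexOn_toReal hR.1 hconv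
    exact (h1.add (hF.subset (Set.subset_univ _) h1.1)).add_const _
  have hw : ∑ _i ∈ Finset.range k, 1 / (k : ℝ) = 1 := by
    simp [hk'.ne']
  have hmem := hc.1.sum_mem (t := Finset.range k) (w := fun _ => 1 / (k : ℝ))
    (z := fun i => u (i + 1)) (fun _ _ => by positivity) hw fun i _ => hu i
  have hle := hc.map_sum_le (t := Finset.range k) (w := fun _ => 1 / (k : ℝ))
    (p := fun i => u (i + 1)) (fun _ _ => by positivity) hw fun i _ => hu i
  rw [← Finset.smul_sum] at hmem hle
  rw [← Finset.smul_sum, smul_eq_mul] at hle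
  rw [hsum, gap_eq_ofReal hR hxs hmem]
  exact ENNReal.ofReal_le_ofReal hle

end Ergodic

/-! ### Convergence to a minimiser -/

section Opial

variable {n m : ℕ}

/-- A sequence in `ℝⁿ` whose distances to the points of a dense subset of `C` converge, and whose
cluster points belong to `C`, converges to a point of `C`. -/
lemma exists_tendsto_of_tendsto_norm_sub {C D : Set (Vec n)} (hDne : D.Nonempty)
    (hCD : C ⊆ closure D) {u : ℕ → Vec n}
    (hd : ∀ d ∈ D, ∃ r, Tendsto (fun k => ‖u k - d‖) atTop (𝓝 r))
    (hC : ∀ z, ∀ φ : ℕ → ℕ, StrictMono φ → Tendsto (u ∘ φ) atTop (𝓝 z) → z ∈ C) :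
    ∃ z ∈ C, Tendsto u atTop (𝓝 z) := by
  obtain ⟨d₀, hd₀⟩ := hDne
  obtain ⟨r₀, hr₀⟩ := hd d₀ hd₀
  obtain ⟨B, hB⟩ := hr₀.bddAbove_range
  have hball : ∀ k, u k ∈ Metric.closedBall d₀ B := fun k => by
    rw [Metric.mem_closedBall, dist_eq_norm]
    exact hB ⟨k, rfl⟩
  obtain ⟨z, -, φ, hφ, hz⟩ := (isCompact_closedBall d₀ B).tendsto_subseq hball
  have hzC := hC z φ hφ hz
  refine ⟨z, hzC, Metric.tendsto_atTop.2 fun ε hε => ?_⟩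
  -- Convergence of distances is known only for points of `D`, so the cluster point is replaced by a
  -- nearby `d`, at the price of one triangle inequality.
  obtain ⟨d, hdD, hdz⟩ := Metric.mem_closure_iff.1 (hCD hzC) (ε / 2) (half_pos hε)
  obtain ⟨r, hr⟩ := hd d hdD
  have h1 : Tendsto (fun k => ‖(u ∘ φ) k - d‖) atTop (𝓝 ‖z - d‖) := (hz.sub_const d).norm
  have h2 : r = ‖z - d‖ := tendsto_nhds_unique (hr.comp hφ.tendsto_atTop) h1
  rw [h2, ← dist_eq_norm] at hr
  obtain ⟨N, hN⟩ := eventually_atTop.1 (hr.eventually_lt_const hdz)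
  refine ⟨N, fun k hk => ?_⟩
  have h3 := hN k hk
  rw [← dist_eq_norm] at h3
  have h4 := dist_triangle_right (u k) z d
  linarith

/-- The limit of a minimising sequence is a minimiser. -/
lemma mem_argmin_of_tendsto {R : Vec n → EReal} {f : Fin m → Vec n → ℝ} (hR : Proper R)
    (hlsc : LowerSemicontinuous R) (hF : Continuous (avg f)) {xs : Vec n}
    (hxs : xs ∈ Argmin (objective R f)) {u : ℕ → Vec n} (hu : ∀ᶠ k in atTop, R (u k) ≠ ⊤)
    (hgap : Tendsto (fun k => realGap R f xs (u k)) atTop (𝓝 0)) {z : Vec n}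
    (hz : Tendsto u atTop (𝓝 z)) : z ∈ Argmin (objective R f) := by
  suffices h : objective R f z ≤ objective R f xs from fun y => h.trans (hxs y)
  by_contra! hlt
  -- Lower semicontinuity keeps the objective above c near z, while the vanishing gap brings it
  -- below c.
  obtain ⟨c, hc1, hc2⟩ := EReal.lt_iff_exists_real_btwn.1 hlt
  have hxst := ne_top_of_mem_argmin hR hxs
  rw [objective_eq_coe hR.1 hxst, EReal.coe_lt_coe_iff] at hc1
  have h1 := hz.eventually (lowerSemicontinuous_add_coe hlsc hF z c hc2)
  have h2 := hgap.eventually_lt_const (sub_pos.2 hc1)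
  obtain ⟨k, hk0, hk1, hk2⟩ := (hu.and (h1.and h2)).exists
  change (c : EReal) < objective R f (u k) at hk1
  rw [objective_eq_coe hR.1 hk0, EReal.coe_lt_coe_iff] at hk1
  rw [realGap] at hk2
  linarith

end Opial

/-! ### The three conclusions -/

section Main

variable {n m P : ℕ} {R : Vec n → EReal} {f : Fin m → Vec n → ℝ} {L γ : ℝ} {x0 : Vec n}
  {Ω : Type*} [MeasurableSpace Ω] {μ : Measure Ω} [IsProbabilityMeasure μ] {s : ℕ → Ω → Fin m}

/-- The only place where the step-size condition is turned into constants: κ = 2γ²L² gives κP² + 1/4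
≤ c with c = 1/2 - γL, and the 1/4 makes the squared steps summable. -/
lemma step_size_bounds (hP : 0 < P) (hL0 : 0 ≤ L) (hγ : 0 < γ) (h : 4 * L * γ * (P + 1) ≤ 1) :
    γ * L ≤ 1 / 8 ∧ 2 * γ ^ 2 * L ^ 2 * P ^ 2 + 1 / 4 ≤ 1 / 2 - γ * L := by
  have hP1 : (1 : ℝ) ≤ P := by exact_mod_cast hP
  have ht : 0 ≤ γ * L := mul_nonneg hγ.le hL0
  have h1 : γ * L * 1 ≤ γ * L * P := mul_le_mul_of_nonneg_left hP1 ht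
  have h2 : γ * L * P + γ * L ≤ 1 / 4 := by linarith
  have h3 : 0 ≤ γ * L * P := by linarith
  refine ⟨by linarith, ?_⟩
  nlinarith

lemma ne_top_step (hm : 0 < m) (hR : Proper R) (hRc : ConvexFun R) (hlsc : LowerSemicontinuous R)
    (hf : ∀ i, Differentiable ℝ (f i))
    (hL : ∀ i x y, ‖gradient (f i) x - gradient (f i) y‖ ≤ L * ‖x - y‖)
    (hF : ConvexOn ℝ Set.univ (avg f)) (hmin : (Argmin (objective R f)).Nonempty)
    (hγ : 0 < γ) (hγL : γ * L < 1) (y : Vec n) (j : Fin m) (x : Vec n) :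
    R (step γ R f y j x) ≠ ⊤ := by
  obtain ⟨xs, hxs⟩ := hmin
  exact (step_inequality hR hlsc (differentiable_avg hf) (norm_gradient_avg_sub_le hm hf hL) hxs
    hγ hγL (strongConvexOn_zero.2 (hRc.convexOn_toReal hR.1)) (strongConvexOn_zero.2 hF) y j x).1

lemma mean_step_inequality_of_convexOn (hm : 0 < m) (hR : Proper R) (hRc : ConvexFun R)
    (hlsc : LowerSemicontinuous R) (hf : ∀ i, Differentiable ℝ (f i))
    (hL : ∀ i x y, ‖gradient (f i) x - gradient (f i) y‖ ≤ L * ‖x - y‖)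
    (hF : ConvexOn ℝ Set.univ (avg f)) {xs : Vec n} (hxs : xs ∈ Argmin (objective R f))
    (hγ : 0 < γ) (hγL : γ * L < 1) (y x : Vec n) :
    1 / (m : ℝ) * ∑ j, (1 * ‖step γ R f y j x - xs‖ ^ 2
        + 2 * γ * realGap R f xs (step γ R f y j x)
        + (1 / 2 - γ * L) * ‖step γ R f y j x - x‖ ^ 2)
      ≤ 1 * ‖x - xs‖ ^ 2 + 2 * γ ^ 2 * L ^ 2 * ‖x - y‖ ^ 2 := by
  simpa using mean_step_inequality hm hR hlsc hf hL hxs hγ hγL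
    (strongConvexOn_zero.2 (hRc.convexOn_toReal hR.1)) (strongConvexOn_zero.2 hF) y x

/-- Almost sure convergence of the iterates and of the gradient errors. -/
lemma exists_ae_tendsto_iter (hm : 0 < m) (hP : 0 < P) (hR : Proper R) (hRc : ConvexFun R)
    (hlsc : LowerSemicontinuous R) (hf : ∀ i, Differentiable ℝ (f i))
    (hL : ∀ i x y, ‖gradient (f i) x - gradient (f i) y‖ ≤ L * ‖x - y‖) (hL0 : 0 ≤ L)
    (hF : ConvexOn ℝ Set.univ (avg f)) (hmin : (Argmin (objective R f)).Nonempty)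
    (hs : ∀ k, Measurable (s k)) (hindep : iIndepFun s μ)
    (hunif : ∀ k j, μ {ω | s k ω = j} = (m : ℝ≥0∞)⁻¹)
    (hγ : 0 < γ) (h : 4 * L * γ * (P + 1) ≤ 1) :
    ∃ X : Ω → Vec n, Measurable X ∧ ∀ᵐ ω ∂μ, X ω ∈ Argmin (objective R f) ∧
      Tendsto (fun k => iter γ P R f x0 (fun j => s j ω) k) atTop (𝓝 (X ω)) ∧
      Tendsto (fun k => err γ P R f x0 (fun j => s j ω) k) atTop (𝓝 0) := by
  obtain ⟨hb1, hb2⟩ := step_size_bounds hP hL0 hγ h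
  have hγL : γ * L < 1 := by linarith
  have hx : IsEpochProcess P (step γ R f) x0 (iter γ P R f x0) := isEpochProcess_iter hP
  have htop := ne_top_step hm hR hRc hlsc hf hL hF hmin hγ hγL
  have hitop : ∀ σ k, R (iter γ P R f x0 σ (k + 1)) ≠ ⊤ := fun σ k => by
    rw [hx.succ]; exact htop _ _ _
  -- The exceptional null set depends on the minimiser, so only countably many minimisers can be
  -- treated at once; a dense set of them suffices.
  obtain ⟨D, hDC, hDcount, hCD⟩ :=
    (TopologicalSpace.IsSeparable.of_separableSpace
      (Argmin (objective R f))).exists_countable_dense_subset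
  have hDne : D.Nonempty := closure_nonempty_iff.1 (hmin.mono hCD)
  have hall : ∀ᵐ ω ∂μ, ∀ d ∈ D,
      (∃ r, Tendsto (fun k => ‖iter γ P R f x0 (fun j => s j ω) k - d‖) atTop (𝓝 r)) ∧
      Summable (fun k => ‖iter γ P R f x0 (fun j => s j ω) (k + 1)
        - iter γ P R f x0 (fun j => s j ω) k‖ ^ 2) ∧
      Tendsto (fun k => 2 * γ * realGap R f d (iter γ P R f x0 (fun j => s j ω) (k + 1))) atTop
        (𝓝 0) := (ae_ball_iff hDcount).2 fun d hd =>
    hx.ae_tendsto (μ := μ) (g := fun z => 2 * γ * realGap R f d z) hP hs hindep hunif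
      (by positivity : 0 ≤ 2 * γ ^ 2 * L ^ 2) (by norm_num : (0 : ℝ) < 1 / 4) hb2
      (mean_step_inequality_of_convexOn hm hR hRc hlsc hf hL hF (hDC hd) hγ hγL)
      fun y j z => mul_nonneg (by positivity) (realGap_nonneg hR (hDC hd) (htop y j z))
  have hlim : ∀ᵐ ω ∂μ, ∃ z ∈ Argmin (objective R f),
      Tendsto (fun k => iter γ P R f x0 (fun j => s j ω) k) atTop (𝓝 z) := by
    filter_upwards [hall] with ω hω
    refine exists_tendsto_of_tendsto_norm_sub hDne hCD (fun d hd => (hω d hd).1) ?_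
    intro z φ hφ hz
    obtain ⟨d, hd⟩ := hDne
    have hgap : Tendsto (fun k => realGap R f d (iter γ P R f x0 (fun j => s j ω) k)) atTop
        (𝓝 0) := by
      have h1 := (hω d hd).2.2.const_mul (2 * γ)⁻¹
      rw [mul_zero] at h1
      -- The gap is controlled only from index 1 on: every prox output lies in the domain of `R`,
      -- the initial point perhaps not.
      refine (tendsto_add_atTop_iff_nat 1).1 (h1.congr fun k => ?_)
      rw [inv_mul_cancel_left₀ (by positivity)]
    refine mem_argmin_of_tendsto hR hlsc (differentiable_avg hf).continuous (hDC hd) ?_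
      (hgap.comp hφ.tendsto_atTop) hz
    filter_upwards [eventually_ge_atTop 1] with k hk
    obtain ⟨i, hi⟩ := Nat.exists_eq_succ_of_ne_zero
      (Nat.one_le_iff_ne_zero.1 (hk.trans (hφ.id_le k)))
    rw [hi]
    exact hitop _ _
  have hmeas : ∀ k, AEMeasurable (fun ω => iter γ P R f x0 (fun j => s j ω) k) μ := fun k =>
    ((DependsOn.measurable_sample hs (hx.dependsOn k)).mono
      ((sampleFiltration s hs).le k) le_rfl).aemeasurable
  obtain ⟨X, hXm, hX⟩ := measurable_limit_of_tendsto_metrizable_ae hmeas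
    (hlim.mono fun ω ⟨z, _, hz⟩ => ⟨z, hz⟩)
  refine ⟨X, hXm, ?_⟩
  filter_upwards [hall, hlim, hX] with ω h1 h2 h3
  obtain ⟨z, hz1, hz2⟩ := h2
  obtain ⟨d, hd⟩ := hDne
  refine ⟨tendsto_nhds_unique hz2 h3 ▸ hz1, h3, ?_⟩
  have h4 := (tendsto_sub_ref hP (h1 d hd).2.1).const_mul (2 * L)
  rw [mul_zero] at h4
  refine squeeze_zero_norm (fun k => ?_) h4
  rw [err_eq_vrErr hP]
  exact norm_vrErr_le hm hf hL _ _ _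

/-- The mean gap of the ergodic averages. -/
lemma lintegral_gap_ergodic_le (hm : 0 < m) (hP : 0 < P) (hR : Proper R) (hRc : ConvexFun R)
    (hlsc : LowerSemicontinuous R) (hf : ∀ i, Differentiable ℝ (f i))
    (hL : ∀ i x y, ‖gradient (f i) x - gradient (f i) y‖ ≤ L * ‖x - y‖) (hL0 : 0 ≤ L)
    (hF : ConvexOn ℝ Set.univ (avg f)) {xs : Vec n} (hxs : xs ∈ Argmin (objective R f))
    (hs : ∀ k, Measurable (s k)) (hindep : iIndepFun s μ)
    (hunif : ∀ k j, μ {ω | s k ω = j} = (m : ℝ≥0∞)⁻¹)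
    (hγ : 0 < γ) (h : 4 * L * γ * (P + 1) ≤ 1) {k : ℕ} (hk : 0 < k) :
    ∫⁻ ω, gap (objective R f) xs (ergodic γ P R f x0 (fun j => s j ω) k) ∂μ
      ≤ ENNReal.ofReal (1 / (k * (2 * γ)) * ‖x0 - xs‖ ^ 2) := by
  obtain ⟨hb1, hb2⟩ := step_size_bounds hP hL0 hγ h
  have hγL : γ * L < 1 := by linarith
  have hk' : (0 : ℝ) < k := by exact_mod_cast hk
  have hx : IsEpochProcess P (step γ R f) x0 (iter γ P R f x0) := isEpochProcess_iter hP
  have htop := ne_top_step hm hR hRc hlsc hf hL hF ⟨xs, hxs⟩ hγ hγL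
  have hitop : ∀ σ k, R (iter γ P R f x0 σ (k + 1)) ≠ ⊤ := fun σ k => by
    rw [hx.succ]; exact htop _ _ _
  have hint : ∀ i, Integrable
      (fun ω => realGap R f xs (iter γ P R f x0 (fun j => s j ω) (i + 1))) μ := fun i =>
    hx.integrable hs (Ψ := fun u => realGap R f xs (u (i + 1))) (k := i + 1) fun u v huv => by
      simp only [huv (i + 1) (Set.mem_Iic.2 le_rfl)]
  have hE : 0 ≤ ∫ ω, energy P 1 (2 * γ ^ 2 * L ^ 2 * P) xs
      (iter γ P R f x0 fun j => s j ω) k ∂μ :=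
    integral_nonneg fun ω => energy_nonneg hP zero_le_one (by positivity) _ _ _
  have hsum := hx.sum_integral_le (μ := μ) (c := 1 / 2 - γ * L) (c' := 0)
    (g := fun z => 2 * γ * realGap R f xs z) hP hs hindep hunif
    (by positivity : 0 ≤ 2 * γ ^ 2 * L ^ 2) (by linarith)
    (mean_step_inequality_of_convexOn hm hR hRc hlsc hf hL hF hxs hγ hγL) k
  simp only [zero_mul, add_zero, integral_const_mul, ← Finset.mul_sum] at hsum
  calc ∫⁻ ω, gap (objective R f) xs (ergodic γ P R f x0 (fun j => s j ω) k) ∂μ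
      ≤ ∫⁻ ω, ENNReal.ofReal (1 / (k : ℝ) * ∑ i ∈ Finset.range k,
          realGap R f xs (iter γ P R f x0 (fun j => s j ω) (i + 1))) ∂μ :=
        lintegral_mono fun ω => gap_average_le hR hRc hF hxs (hitop _) hk
    _ = ENNReal.ofReal (∫ ω, 1 / (k : ℝ) * ∑ i ∈ Finset.range k,
          realGap R f xs (iter γ P R f x0 (fun j => s j ω) (i + 1)) ∂μ) := by
        refine (ofReal_integral_eq_lintegral_ofReal
          ((integrable_finsetSum _ fun i _ => hint i).const_mul _) (ae_of_all _ fun ω => ?_)).symm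
        exact mul_nonneg (by positivity)
          (Finset.sum_nonneg fun i _ => realGap_nonneg hR hxs (hitop _ _))
    _ ≤ ENNReal.ofReal (1 / (k * (2 * γ)) * ‖x0 - xs‖ ^ 2) := by
        refine ENNReal.ofReal_le_ofReal ?_
        rw [integral_const_mul, integral_finsetSum _ fun i _ => hint i, one_div_mul_eq_div,
          one_div_mul_eq_div, ← div_div, div_right_comm]
        refine div_le_div_of_nonneg_right ?_ hk'.le
        rw [le_div_iff₀ (by positivity)]
        linarith

/-- Linear convergence in mean square of the reference points in the strongly convex case. -/
lemma integral_norm_outer_sub_sq_le (hm : 0 < m) (hP : 0 < P) (hR : Proper R)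
    (hlsc : LowerSemicontinuous R) (hf : ∀ i, Differentiable ℝ (f i))
    (hL : ∀ i x y, ‖gradient (f i) x - gradient (f i) y‖ ≤ L * ‖x - y‖) (hL0 : 0 ≤ L)
    {αR αF : ℝ} (hαR : 0 ≤ αR) (hαF : 0 ≤ αF)
    (hRc : StrongConvexOn {x | R x ≠ ⊤} αR (fun x => (R x).toReal))
    (hF : StrongConvexOn Set.univ αF (avg f)) {xs : Vec n} (hxs : xs ∈ Argmin (objective R f))
    (hs : ∀ k, Measurable (s k)) (hindep : iIndepFun s μ)
    (hunif : ∀ k j, μ {ω | s k ω = j} = (m : ℝ≥0∞)⁻¹)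
    (hγ : 0 < γ) (h : 4 * L * γ * (P + 1) ≤ 1) {ρ : ℝ} (hρ0 : 0 ≤ ρ)
    (hρ : (1 - γ * αF) / (1 + γ * αR) ≤ ρ) (l : ℕ) :
    ∫ ω, ‖outer γ P R f x0 (fun j => s j ω) l - xs‖ ^ 2 ∂μ ≤ ρ ^ l * ‖x0 - xs‖ ^ 2 := by
  obtain ⟨hb1, hb2⟩ := step_size_bounds hP hL0 hγ h
  have hγL : γ * L < 1 := by linarith
  have hx : IsEpochProcess P (step γ R f) x0 (iter γ P R f x0) := isEpochProcess_iter hP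
  have hRα : 0 ≤ γ * αR := mul_nonneg hγ.le hαR
  have hFα : 0 ≤ γ * αF := mul_nonneg hγ.le hαF
  have ha : 0 < 1 + γ * αR := by linarith
  rw [div_le_iff₀ ha] at hρ
  have htop : ∀ y j z, R (step γ R f y j z) ≠ ⊤ := fun y j z =>
    (step_inequality hR hlsc (differentiable_avg hf) (norm_gradient_avg_sub_le hm hf hL) hxs
      hγ hγL hRc hF y j z).1
  induction l with
  | zero => simp [outer]
  | succ l ih =>
    have h1 := hx.integral_epoch_le (μ := μ) (c := 1 / 2 - γ * L)
      (g := fun z => 2 * γ * realGap R f xs z) hP hs hindep hunif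
      (by linarith : 1 - γ * αF ≤ 1 + γ * αR) (by positivity : 0 ≤ 2 * γ ^ 2 * L ^ 2)
      (by linarith) (mean_step_inequality hm hR hlsc hf hL hxs hγ hγL hRc hF)
      (fun y j z => mul_nonneg (by positivity) (realGap_nonneg hR hxs (htop y j z))) l
    simp_rw [iter_mul_self hP] at h1
    have h2 : 0 ≤ ∫ ω, ‖outer γ P R f x0 (fun j => s j ω) l - xs‖ ^ 2 ∂μ :=
      integral_nonneg fun ω => sq_nonneg _
    -- Here 1 - γα_F ≤ ρ(1 + γα_R); the common positive factor is then cancelled, which is valid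
    -- also when 1 - γα_F is negative.
    have h3 := h1.trans (mul_le_mul_of_nonneg_right hρ h2)
    rw [mul_comm ρ, mul_assoc] at h3
    have h4 := le_of_mul_le_mul_left h3 ha
    refine h4.trans ?_
    rw [pow_succ', mul_assoc]
    exact mul_le_mul_of_nonneg_left ih hρ0

end Main

end ProxSVRG

/-! ### The theorem: passage to the stated constants. -/

theorem theorem2p2
    {n m P : ℕ} (hm : 0 < m) (hP : 0 < P)
    -- the non-smooth term
    (R : ProxSVRG.Vec n → EReal) (hR_proper : ProxSVRG.Proper R)
    (hR_convex : ProxSVRG.ConvexFun R) (hR_lsc : LowerSemicontinuous R)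
    -- the smooth terms, with Lipschitz gradients, and their convex average
    (f : Fin m → ProxSVRG.Vec n → ℝ) (hf : ∀ i, ContDiff ℝ 1 (f i))
    (Lip : Fin m → ℝ≥0) (hLip : ∀ i, LipschitzWith (Lip i) (gradient (f i)))
    (L : ℝ≥0) (hL : IsGreatest (Set.range Lip) L)
    (hF : ConvexOn ℝ Set.univ (ProxSVRG.avg f))
    -- minimisers exist
    (hmin : (ProxSVRG.Argmin (ProxSVRG.objective R f)).Nonempty)
    -- independent uniform samples
    {Ω : Type*} [MeasurableSpace Ω] (μ : Measure Ω) [IsProbabilityMeasure μ]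
    (s : ℕ → Ω → Fin m) (hs_meas : ∀ k, Measurable (s k)) (hs_indep : iIndepFun s μ)
    (hs_unif : ∀ k j, μ {ω | s k ω = j} = (m : ℝ≥0∞)⁻¹)
    -- initial point and step-size
    (x0 : ProxSVRG.Vec n) (γ : ℝ) (hγ : 0 < γ) :
    -- (i)
    (4 * L * γ * (P + 2) ≤ 1 →
      (∃ X : Ω → ProxSVRG.Vec n, Measurable X ∧
        ∀ᵐ ω ∂μ, X ω ∈ ProxSVRG.Argmin (ProxSVRG.objective R f) ∧
          Tendsto (fun k => ProxSVRG.iter γ P R f x0 (fun j => s j ω) k) atTop (𝓝 (X ω)) ∧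
          Tendsto (fun k => ProxSVRG.err γ P R f x0 (fun j => s j ω) k) atTop (𝓝 0)) ∧
      ∀ xs ∈ ProxSVRG.Argmin (ProxSVRG.objective R f), ∀ l : ℕ, 1 ≤ l → ∀ k : ℕ, k = l * P →
        (8 * L * γ ^ 2 * (P + 1) ≤ 2 * γ - γ ^ 2 →
          ∫⁻ ω, ProxSVRG.gap (ProxSVRG.objective R f) xs
              (ProxSVRG.ergodic γ P R f x0 (fun j => s j ω) k) ∂μ
            ≤ ENNReal.ofReal (1 / (k * γ ^ 2)) *
              (ENNReal.ofReal (‖x0 - xs‖ ^ 2) + ENNReal.ofReal (2 * γ - γ ^ 2) *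
                ProxSVRG.gap (ProxSVRG.objective R f) xs x0)) ∧
        ∫⁻ ω, ProxSVRG.gap (ProxSVRG.objective R f) xs
            (ProxSVRG.ergodic γ P R f x0 (fun j => s j ω) k) ∂μ
          ≤ ENNReal.ofReal (1 / (k * (2 * γ * (1 - 4 * L * γ * (P + 1))))) *
            (ENNReal.ofReal (‖x0 - xs‖ ^ 2) + ENNReal.ofReal (8 * L * γ ^ 2 * (P + 1)) *
              ProxSVRG.gap (ProxSVRG.objective R f) xs x0)) ∧
    -- (ii)
    (∀ αR αF : ℝ, 0 < αR → 0 < αF →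
      ProxSVRG.StronglyConvexFun αR R → StrongConvexOn Set.univ αF (ProxSVRG.avg f) →
      4 * L * γ * (P + 1) < 1 →
      max ((1 - γ * αF) / (1 + γ * αR)) (4 * L * γ * (P + 1)) < 1 ∧
      ∀ xs ∈ ProxSVRG.Argmin (ProxSVRG.objective R f), ∀ l : ℕ,
        ∫⁻ ω, ENNReal.ofReal (‖ProxSVRG.outer γ P R f x0 (fun j => s j ω) l - xs‖ ^ 2) ∂μ
          ≤ ENNReal.ofReal (max ((1 - γ * αF) / (1 + γ * αR)) (4 * L * γ * (P + 1)) ^ l) *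
            (ENNReal.ofReal (‖x0 - xs‖ ^ 2) + ENNReal.ofReal (2 * γ / (1 + γ * αR)) *
              ProxSVRG.gap (ProxSVRG.objective R f) xs x0)) := by
  have hfd : ∀ i, Differentiable ℝ (f i) := fun i => (hf i).differentiable one_ne_zero
  have hLip' : ∀ i x y, ‖gradient (f i) x - gradient (f i) y‖ ≤ (L : ℝ) * ‖x - y‖ := by
    intro i x y
    have h1 := (hLip i).dist_le_mul x y
    rw [dist_eq_norm, dist_eq_norm] at h1
    exact h1.trans (mul_le_mul_of_nonneg_right (by exact_mod_cast hL.2 ⟨i, rfl⟩) (norm_nonneg _))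
  have hL0 : (0 : ℝ) ≤ L := L.coe_nonneg
  have hP1 : (1 : ℝ) ≤ P := by exact_mod_cast hP
  have hLγ : 0 ≤ 4 * L * γ := by positivity
  refine ⟨fun h => ?_, fun αR αF hαR hαF hRs hFs h => ?_⟩
  · have h' : 4 * L * γ * (P + 1) ≤ 1 := by linarith
    refine ⟨ProxSVRG.exists_ae_tendsto_iter hm hP hR_proper hR_convex hR_lsc hfd hLip' hL0 hF hmin
      hs_meas hs_indep hs_unif hγ h', ?_⟩
    intro xs hxs l hl k hk
    have hk0 : 0 < k := hk ▸ Nat.mul_pos hl hP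
    have hk' : (0 : ℝ) < k := by exact_mod_cast hk0
    have hbound := ProxSVRG.lintegral_gap_ergodic_le (x0 := x0) hm hP hR_proper hR_convex hR_lsc
      hfd hLip' hL0 hF hxs hs_meas hs_indep hs_unif hγ h' hk0
    -- Both rates follow from ‖x0-xs‖²/(2γk): the prefactors 1/(kq) have q ≤ 2γ, and the added
    -- multiple `G` of the initial gap, possibly infinite, only enlarges the right-hand side.
    have hcoef : ∀ q : ℝ, 0 < q → q ≤ 2 * γ → ∀ G : ℝ≥0∞,
        ENNReal.ofReal (1 / (k * (2 * γ)) * ‖x0 - xs‖ ^ 2)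
          ≤ ENNReal.ofReal (1 / (k * q)) * (ENNReal.ofReal (‖x0 - xs‖ ^ 2) + G) := by
      intro q hq hq2 G
      rw [ENNReal.ofReal_mul (by positivity)]
      refine mul_le_mul' (ENNReal.ofReal_le_ofReal ?_) le_self_add
      exact one_div_le_one_div_of_le (by positivity) (mul_le_mul_of_nonneg_left hq2 hk'.le)
    refine ⟨fun h2 => hbound.trans (hcoef _ (by positivity) ?_ _),
      hbound.trans (hcoef _ ?_ ?_ _)⟩
    · have : 0 ≤ 8 * L * γ ^ 2 * (P + 1) := by positivity
      linarith
    · refine mul_pos (by linarith) ?_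
      -- Strict positivity of 1 - 4Lγ(P+1): immediate if L = 0, and otherwise from P + 1 < P + 2.
      rcases hLγ.eq_or_lt with h0 | h0
      · rw [← h0]; norm_num
      · linarith
    · have : 0 ≤ 2 * γ * (4 * L * γ * (P + 1)) := by positivity
      linarith
  · have hRα : 0 < γ * αR := mul_pos hγ hαR
    have hFα : 0 < γ * αF := mul_pos hγ hαF
    refine ⟨max_lt ?_ h, fun xs hxs l => ?_⟩
    · rw [div_lt_one (by linarith)]
      linarith
    set ρ := max ((1 - γ * αF) / (1 + γ * αR)) (4 * L * γ * (P + 1)) with hρ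
    -- The second entry of the maximum keeps ρ nonnegative even if γα_F > 1.
    have hρ0 : 0 ≤ ρ := le_max_of_le_right (by positivity)
    have hbound := ProxSVRG.integral_norm_outer_sub_sq_le (x0 := x0) hm hP hR_proper hR_lsc hfd
      hLip' hL0 hαR.le hαF.le (hRs.strongConvexOn hR_proper.1) hFs hxs hs_meas hs_indep hs_unif
      hγ h.le hρ0 (le_max_left _ _) l
    have hint : Integrable
        (fun ω => ‖ProxSVRG.outer γ P R f x0 (fun j => s j ω) l - xs‖ ^ 2) μ := by
      simp_rw [← ProxSVRG.iter_mul_self hP]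
      refine (ProxSVRG.isEpochProcess_iter hP).integrable hs_meas
        (Ψ := fun u => ‖u (l * P) - xs‖ ^ 2) (k := l * P) fun u v huv => ?_
      simp only [huv (l * P) (Set.mem_Iic.2 le_rfl)]
    rw [← ofReal_integral_eq_lintegral_ofReal hint (ae_of_all _ fun ω => sq_nonneg _)]
    refine (ENNReal.ofReal_le_ofReal hbound).trans ?_
    rw [ENNReal.ofReal_mul (by positivity)]
    exact mul_le_mul' le_rfl le_self_add
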